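/- **Setting.** Let $F$ be a field of any characteristic and let $D$ be a diagram of a knot $K$ with a base point (the diagram may have no crossings). Let $C=\mathit{CKh}_h(D;F)$ be the Bar-Natan complex of $D$, i.e. the Khovanov complex over $F[h]$ built from the Frobenius algebra $A=F[h][X]/(X^2-hX)$ with counit $\epsilon(1)=0$, $\epsilon(X)=1$, so that $\Delta(1)=1\otimes X+X\otimes 1-h(1\otimes 1)$ and $\Delta(X)=X\otimes X$. It is bigraded by the usual homological grading and by the quantum grading with $\deg h=2$, in which the enhanced state at a vertex $v$ of the cube of resolutions has degree $\#\{X\text{-labels}\}-\#\{1\text{-labels}\}-|v|-n_++2n_-$ (the opposite of Khovanov's original convention). Put $Y=X-h$, and let $\widetilde C\subset C$ be either of the two subcomplexes $C_X$, $C_Y$ generated by the states whose label on the circle through the base point is $X$, respectively $Y$; its quantum grading is shifted by $-1$. Write $\mathit{Kh}_h(D;F)=H(C)$ and $\widetilde{\mathit{Kh}}_h(D;F)=H(\widetilde C)$, and let $\mathrm{Tor}$ denote the $F[h]$-torsion submodule. Let $\widehat\sigma$ be the $F$-linear involution of $C$ that on each summand $A^{\otimes r}$ is the tensor power of the ring involution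 $h\mapsto -h$, $X\mapsto X-h$ of $A$, and let $\widehat\nu=(\mathrm{id}-\widehat\sigma)/h$ be the signed Shumakovitch operation. **Proposition.** 1. $\widetilde{\mathit{Kh}}_h(D;F)/\mathrm{Tor}\cong F[h]$ and $\mathit{Kh}_h(D;F)/\mathrm{Tor}\cong F[h]^2$ as $F[h]$-modules. 2. If $z\in\widetilde C$ is a cycle whose class generates $\widetilde{\mathit{Kh}}_h(D;F)/\mathrm{Tor}$, then $z$ and $\widehat\nu(z)$ are cycles of $C$ and their classes form an $F[h]$-basis of $\mathit{Kh}_h(D;F)/\mathrm{Tor}$. 3. The unreduced and reduced Rasmussen invariants over $F$ are well defined from $D$ and agree, $s^F(K)=\tilde s^F(K)$. That is, there is an integer $s$ such that: - $s$ is the unique integer for which $\mathit{Kh}_h(D;F)/\mathrm{Tor}$ has an $F[h]$-basis of two classes represented by homogeneous cycles in homological degree $0$ and quantum degrees $-s-1$ and $-s+1$; - $s$ is also the unique integer for which $\widetilde{\mathit{Kh}}_h(D;F)/\mathrm{Tor}$ has an $F[h]$-basis of one class represented by a homogeneous cycle in homological degree $0$ and (shifted) quantum degree $-s$. -/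

import Mathlib

open scoped Polynomial

noncomputable section

namespace BarNatan

/-! ### Pointed knot diagrams, as signed Gauss diagrams -/

/-- An oriented pointed signed Gauss diagram with `n` crossings.  Walking once around the circle one
meets the base point `none` and passes every crossing `c` twice, on the over-strand
`some (c, true)` and on the under-strand `some (c, false)`; `next p` is what is met right after `p`.
`positive c` says that `c` is a positive crossing. -/
structure GaussDiagram where
  n : ℕ
  positive : Fin n → Bool
  next : Equiv.Perm (Option (Fin n × Bool))
  single_component : next.IsCycleOn Set.univ

namespace GaussDiagram

variable (G : GaussDiagram)

/-- The points met when walking along the knot: the base point and the passages through crossings. -/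
abbrev Passage : Type := Option (Fin G.n × Bool)

/-- The edges of the diagram (arcs between consecutive passages, so that the base point is a
two-valent vertex).  The edge called `p` runs from `p` to `next p`. -/
abbrev Edge : Type := G.Passage

/-- The edge that leaves the passage `p`. -/
abbrev outEdge (p : G.Passage) : G.Edge := p

/-- The edge that arrives at the passage `p`. -/
abbrev inEdge (p : G.Passage) : G.Edge := G.next.symm p

/-- A directed edge: `(e, true)` is `e` with the direction of the knot, `(e, false)` is `e`
with the opposite direction. -/
abbrev Dart : Type := G.Edge × Bool

/-- The dart that follows, on the boundary of the face, a dart which has arrived at the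
passage `p` moving along (`dir = true`) or against (`dir = false`) the direction of the knot:
the base point is passed straight, and at a crossing one leaves by the clockwise next edge.
The counterclockwise order of the edges at a crossing is
`in-under, out-over, out-under, in-over` if the crossing is positive, and
`in-under, in-over, out-under, out-over` if it is negative. -/
def turn : G.Passage → Bool → G.Dart
  | none, true => (G.outEdge none, true)
  | none, false => (G.inEdge none, false)
  | some (c, o), dir =>
      if G.positive c = (dir == o) then (G.outEdge (some (c, !o)), true)
      else (G.inEdge (some (c, !o)), false)

/-- One step along the boundary of a face. -/
def faceStep : G.Dart → G.Dart
  | (e, true) => G.turn (G.next e) true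
  | (e, false) => G.turn e false

/-- The faces: the orbits of `faceStep`. -/
def Face : Type := Quot fun d d' : G.Dart => d' = G.faceStep d

/-- Number of positive crossings. -/
def nPos : ℕ := (Finset.univ.filter fun c => G.positive c = true).card

/-- Number of negative crossings. -/
def nNeg : ℕ := (Finset.univ.filter fun c => G.positive c = false).card

end GaussDiagram

/-- A pointed knot diagram on the sphere: the surface of the Gauss diagram has genus zero.  It is
connected, with `n + 1` vertices and `2 * n + 1` edges (counting the base point as a vertex), so
its Euler characteristic is `2` exactly when it has `n + 2` faces. -/
structure KnotDiagram extends GaussDiagram where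
  planar : Nat.card toGaussDiagram.Face = n + 2

namespace KnotDiagram

variable (D : KnotDiagram)

/-! ### The cube of resolutions -/

/-- A vertex of the cube of resolutions: `v c = false` is the `0`-smoothing of the crossing `c` and
`v c = true` is its `1`-smoothing. -/
abbrev Vertex : Type := Fin D.n → Bool

/-- The pairs of edges that are joined in the resolution `v`.  The `0`-smoothing of a positive
crossing and the `1`-smoothing of a negative one respect the orientation; the other smoothings join
the two incoming edges, and the two outgoing edges. -/
inductive Joined (v : D.Vertex) : D.Edge → D.Edge → Prop
  | base : Joined v (D.inEdge none) (D.outEdge none)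
  | oriented (c : Fin D.n) (o : Bool) (hc : v c = !(D.positive c)) :
      Joined v (D.inEdge (some (c, o))) (D.outEdge (some (c, !o)))
  | disoriented_in (c : Fin D.n) (hc : v c = D.positive c) :
      Joined v (D.inEdge (some (c, true))) (D.inEdge (some (c, false)))
  | disoriented_out (c : Fin D.n) (hc : v c = D.positive c) :
      Joined v (D.outEdge (some (c, true))) (D.outEdge (some (c, false)))

/-- The circles of the resolution `v`. -/
abbrev Circle (v : D.Vertex) : Type := Quot (D.Joined v)

/-- The circle of the resolution `v` that contains the edge `e`. -/
abbrev circle (v : D.Vertex) (e : D.Edge) : D.Circle v := Quot.mk _ e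

instance (v : D.Vertex) : Fintype (D.Circle v) := Fintype.ofFinite _

instance (v : D.Vertex) : DecidableEq (D.Circle v) := Classical.decEq _

end KnotDiagram

/-- The basis `1, X` of the Frobenius algebra `A = F[h][X] / (X ^ 2 - h X)` over `F[h]`. -/
inductive Label : Type
  | one
  | X
  deriving DecidableEq

instance : Fintype Label := ⟨{Label.one, Label.X}, fun a => by cases a <;> simp⟩

open Label

/-- An enhanced state: a resolution with a label on each of its circles. -/
abbrev KnotDiagram.State (D : KnotDiagram) : Type :=
  Σ v : D.Vertex, (D.Circle v → Label)

variable (F : Type*) [Field F]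

/-- The element `h` of the ground ring `F[h]`, which is Mathlib's `F[X]`. -/
abbrev h : F[X] := Polynomial.X

/-- The coefficient of `c` in the product `a * b` in `A`; note `X * X = h X`. -/
def mulCoeff : Label → Label → Label → F[X]
  | one, one, one => 1
  | one, X, X => 1
  | X, one, X => 1
  | X, X, X => h F
  | _, _, _ => 0

/-- The coefficient of `b ⊗ c` in the coproduct `Δ a`, where `Δ 1 = 1 ⊗ X + X ⊗ 1 - h (1 ⊗ 1)` and
`Δ X = X ⊗ X`. -/
def comulCoeff : Label → Label → Label → F[X]
  | one, one, X => 1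
  | one, X, one => 1
  | one, one, one => - h F
  | X, X, X => 1
  | _, _, _ => 0

/-- The coefficient of `b` in `σ̂ a`, where `σ̂ 1 = 1` and `σ̂ X = X - h`. -/
def sigmaCoeff : Label → Label → F[X]
  | one, one => 1
  | X, X => 1
  | X, one => - h F
  | _, _ => 0

variable (D : KnotDiagram)

/-! ### The Bar-Natan complex -/

/-- The underlying `F[h]`-module of the complex: the free module on the enhanced states, that is,
the direct sum over the resolutions `v` of the tensor powers `A ^ ⊗ (circles of v)`. -/
abbrev Chain : Type _ := D.State → F[X]

/-- The coefficient of `t` in the image of `s` under the map that changes the smoothing of the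
crossing `c` (for `t.1 = s.1` with `c` changed).  The two strands of either smoothing of `c` are
represented by the incoming and the outgoing edge of its over-strand.  Two circles are merged by the
multiplication, or one circle is split by the comultiplication; labels of the circles away from `c`
must not change.  In a planar diagram there is no third case. -/
def edgeCoeff (c : Fin D.n) (s t : D.State) : F[X] :=
  letI := Classical.propDecidable
  let a := D.inEdge (some (c, true))
  let b := D.outEdge (some (c, true))
  if ∀ e : D.Edge, D.circle s.1 e ≠ D.circle s.1 a → D.circle s.1 e ≠ D.circle s.1 b →
      t.2 (D.circle t.1 e) = s.2 (D.circle s.1 e) then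
    if D.circle s.1 a ≠ D.circle s.1 b ∧ D.circle t.1 a = D.circle t.1 b then
      mulCoeff F (s.2 (D.circle s.1 a)) (s.2 (D.circle s.1 b)) (t.2 (D.circle t.1 a))
    else if D.circle s.1 a = D.circle s.1 b ∧ D.circle t.1 a ≠ D.circle t.1 b then
      comulCoeff F (s.2 (D.circle s.1 a)) (t.2 (D.circle t.1 a)) (t.2 (D.circle t.1 b))
    else 0
  else 0

/-- The matrix of the differential, with the usual signs of the cube. -/
def differentialMatrix : Matrix D.State D.State F[X] := fun t s =>
  ∑ c : Fin D.n,
    if s.1 c = false ∧ t.1 = Function.update s.1 c true then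
      (-1) ^ (Finset.univ.filter fun j => j < c ∧ s.1 j = true).card * edgeCoeff F D c s t
    else 0

/-- The differential of the unreduced complex. -/
def differential : Chain F D →ₗ[F[X]] Chain F D := (differentialMatrix F D).mulVecLin

/-- Homological degree of an enhanced state. -/
def hDegree (s : D.State) : ℤ :=
  ((Finset.univ.filter fun c => s.1 c = true).card : ℤ) - D.nNeg

/-- Quantum degree of an enhanced state, in the convention with `deg h = 2` and `deg X = deg 1 + 2`
(the opposite of Khovanov's original one). -/
def qDegree (s : D.State) : ℤ :=
  (∑ k : D.Circle s.1, if s.2 k = X then (1 : ℤ) else -1)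
    - ((Finset.univ.filter fun c => s.1 c = true).card : ℤ) - D.nPos + 2 * D.nNeg

variable {F D}

/-- The chain `x` is homogeneous of homological degree `i` and quantum degree `j`. -/
def IsHomogeneous (x : Chain F D) (i j : ℤ) : Prop :=
  ∀ (s : D.State) (k : ℕ), (x s).coeff k ≠ 0 → hDegree D s = i ∧ qDegree D s + 2 * k = j

/-! ### The signed involution and the signed Shumakovitch operation -/

/-- The signed involution `σ̂`: on each `A ^ ⊗ r` it is the tensor power of the ring involution of `A`
with `h ↦ -h` and `X ↦ X - h`. -/
def hatSigma (x : Chain F D) : Chain F D := fun t =>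
  ∑ l : D.Circle t.1 → Label,
    (∏ k, sigmaCoeff F (l k) (t.2 k)) * (x ⟨t.1, l⟩).comp (- h F)

/-- The signed Shumakovitch operation `ν̂ = (id - σ̂) / h`. -/
def hatNu (x : Chain F D) : Chain F D := fun t => (x t - hatSigma x t).divX

/-- The division by `h` in the definition of `ν̂` is exact. -/
theorem h_smul_hatNu (x : Chain F D) : h F • hatNu x = x - hatSigma x := by
  have key : ∀ a b : Label, (sigmaCoeff F a b).eval 0 = if a = b then 1 else 0 := by
    intro a b
    cases a <;> cases b <;> simp [sigmaCoeff]
  funext t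
  have h0 : (x t - hatSigma x t).coeff 0 = 0 := by
    rw [Polynomial.coeff_zero_eq_eval_zero, Polynomial.eval_sub, hatSigma,
      Polynomial.eval_finsetSum, Finset.sum_eq_single t.2]
    · simp [Polynomial.eval_prod, key, Polynomial.eval_comp]
    · intro l _ hl
      obtain ⟨k, hk⟩ := Function.ne_iff.mp hl
      rw [Polynomial.eval_mul, Polynomial.eval_prod,
        Finset.prod_eq_zero (Finset.mem_univ k) (by rw [key, if_neg hk]), zero_mul]
    · simp
  have h1 := Polynomial.X_mul_divX_add (x t - hatSigma x t)
  rw [h0, Polynomial.C_0, add_zero] at h1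
  simpa [hatNu] using h1

variable (F D)

/-! ### The reduced complexes -/

/-- The circle of the resolution `v` that contains the base point. -/
abbrev baseCircle (v : D.Vertex) : D.Circle v := D.circle v (D.outEdge none)

/-- The chain that is the single enhanced state `(v, l)`. -/
def stateChain (v : D.Vertex) (l : D.Circle v → Label) : Chain F D :=
  letI := Classical.decEq D.State
  Pi.single ⟨v, l⟩ 1

/-- The subcomplex `C_X` generated by the enhanced states with label `X` on the pointed circle. -/
def complexX : Submodule F[X] (Chain F D) :=
  Submodule.span F[X]
    {x | ∃ (v : D.Vertex) (l : D.Circle v → Label),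
      x = stateChain F D v (Function.update l (baseCircle D v) X)}

/-- The subcomplex `C_Y` generated by the enhanced states with `Y = X - h` on the pointed circle. -/
def complexY : Submodule F[X] (Chain F D) :=
  Submodule.span F[X]
    {x | ∃ (v : D.Vertex) (l : D.Circle v → Label),
      x = stateChain F D v (Function.update l (baseCircle D v) X)
        - h F • stateChain F D v (Function.update l (baseCircle D v) one)}

variable {F D}

/-! ### Homology modulo torsion

The following is applied to the whole complex `⊤` and to its subcomplexes `C_X` and `C_Y`. -/

/-- The cycles of the subcomplex `C`. -/
def cycles (C : Submodule F[X] (Chain F D)) : Submodule F[X] (Chain F D) :=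
  C ⊓ LinearMap.ker (differential F D)

/-- The total homology of the subcomplex `C`: cycles modulo boundaries. -/
abbrev Homology (C : Submodule F[X] (Chain F D)) : Type _ :=
  cycles C ⧸ (C.map (differential F D)).submoduleOf (cycles C)

/-- The homology of `C` modulo its `F[h]`-torsion. -/
abbrev HomologyModTorsion (C : Submodule F[X] (Chain F D)) : Type _ :=
  Homology C ⧸ Submodule.torsion F[X] (Homology C)

/-- The class of a cycle in the homology modulo torsion. -/
def cycleClass (C : Submodule F[X] (Chain F D)) : cycles C →ₗ[F[X]] HomologyModTorsion C :=
  (Submodule.mkQ _).comp (Submodule.mkQ _)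

/-- The chains `z i` are cycles of `C` whose classes form an `F[h]`-basis of the homology of `C`
modulo torsion. -/
def IsBasisModTorsion {ι : Type*} (C : Submodule F[X] (Chain F D)) (z : ι → Chain F D) : Prop :=
  ∃ hz : ∀ i, z i ∈ cycles C,
    LinearIndependent F[X] (fun i => cycleClass C ⟨z i, hz i⟩) ∧
    Submodule.span F[X] (Set.range fun i => cycleClass C ⟨z i, hz i⟩) = ⊤

variable (F D)

/-- `s` is the unreduced Rasmussen invariant: the unreduced homology modulo torsion has a basis of two
classes in homological degree `0`, in quantum degrees `-s - 1` and `-s + 1`. -/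
def IsRasmussenInvariant (s : ℤ) : Prop :=
  ∃ a b : Chain F D, IsHomogeneous a 0 (-s - 1) ∧ IsHomogeneous b 0 (-s + 1) ∧
    IsBasisModTorsion ⊤ ![a, b]

variable {F D}

/-- `s` is the reduced Rasmussen invariant with respect to the reduced complex `C` (which is `C_X` or
`C_Y`): its homology modulo torsion is generated freely by one class, in homological degree `0` and
in quantum degree `-s`.  The quantum degree in the reduced complex is the quantum degree in the
unreduced complex shifted by `-1`. -/
def IsReducedRasmussenInvariant (C : Submodule F[X] (Chain F D)) (s : ℤ) : Prop :=
  ∃ a : Chain F D, IsHomogeneous a 0 (-s + 1) ∧ IsBasisModTorsion C ![a]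

end BarNatan

end

open BarNatan

/-!
Everything is read off from the evaluations of a chain at coloured resolutions.  The ring `A` has two
homomorphisms to `F[h]`, `X ↦ h` and `X ↦ 0`, so a colouring `κ` of the circles of a resolution `v`
gives a functional `colorEval v κ` on the summand `A ^ ⊗ r` at `v`.  Together these functionals are
injective (`chain_ext`), and they diagonalise the structure: a merge becomes multiplication by `1`, a
split becomes multiplication by `± h`, labels act by scalars, `σ̂` exchanges the two colours, and the
complexes `C_X`, `C_Y` are cut out by fixing the colour of the base point (`complexX_eq`,
`complexY_eq`).

Planarity is used once.  By a dimension count over `ZMod 2`, all edges together are the coboundary of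
a two-colouring of the faces; the colours of the faces to one side of the edges form an alternating
colouring of the edges (`exists_isAlternating`).  Read as a source-sink orientation, it directs the
circles of all resolutions at once, so that changing a smoothing composes a permutation with a
transposition.  Hence every edge of the cube is a merge or a split (`circle_flip_eq_iff`).

The edge maps of a crossing, taken backwards, are a homotopy between `0` and the sum of the actions of
`X` on the two edges of a strand, minus `h` (`homotopy`).  Following the knot from the base point, on
the homology of a reduced complex every edge acts by `h` or by `0`, as prescribed by the alternating
colouring, which is compatible with the oriented resolution only.  So a cycle is torsion exactly if
its evaluation `canonicalEval b` at this colouring vanishes, and the homology of `C_X`, `C_Y` and `C`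
modulo torsion is the module of values of the two functionals `canonicalEval true` and
`canonicalEval false` on cycles (`Detected.isBasisModTorsion_iff`).  For the reduced complexes it is a
nonzero graded ideal of `F[h]`, generated by the value `h ^ k` of a homogeneous cycle.

The evaluation of `ν̂ z` is `± h ^ (k - 1)` at both colourings.  A cycle `w` of `C` can be corrected by
`ν̂` of a cycle of the other reduced complex to a cycle of the given one, so `z` and `ν̂ z` form a basis
(`isBasisModTorsion_hatNu`).  The degree of the determinant of a homogeneous basis determines the
Rasmussen invariant, and `ν̂` lowers the quantum degree by `2`, so that the two invariants agree.
-/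

noncomputable section

namespace BarNatan

/-! ### The alternating colouring of a planar diagram -/

namespace GaussDiagram

variable (G : GaussDiagram)

/-- A two-colouring of the edges that changes at every passage through a crossing, is constant along
the strands of the oriented smoothings, and does not change at the base point.  Read as "the edge
is directed along (`true`) or against (`false`) the knot" it is a source-sink orientation. -/
structure IsAlternating (κ : G.Edge → Bool) : Prop where
  base : κ (G.inEdge none) = κ (G.outEdge none)
  oriented : ∀ c o, κ (G.inEdge (some (c, o))) = κ (G.outEdge (some (c, !o)))
  changes : ∀ c o, κ (G.inEdge (some (c, o))) = !κ (G.outEdge (some (c, o)))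

variable {G}

theorem IsAlternating.not {κ : G.Edge → Bool} (hκ : G.IsAlternating κ) :
    G.IsAlternating fun e => !κ e :=
  ⟨by simp [hκ.base], fun c o => by simp [hκ.oriented c o], fun c o => by simp [hκ.changes c o]⟩

variable (G)

/-- Walking along the knot reaches every edge. -/
theorem next_induction {p : G.Edge → Prop} {e : G.Edge} (h0 : p e)
    (hs : ∀ e, p e → p (G.next e)) (e' : G.Edge) : p e' := by
  obtain ⟨k, hk⟩ := (G.single_component.2 (Set.mem_univ e) (Set.mem_univ e')).exists_nat_pow_eq
  rw [← hk]
  clear hk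
  induction k with
  | zero => exact h0
  | succ k ih => rw [pow_succ', Equiv.Perm.mul_apply]; exact hs _ ih

theorem const_of_next {α : Type*} (f : G.Edge → α) (hf : ∀ e, f (G.next e) = f e) (e e' : G.Edge) :
    f e = f e' :=
  G.next_induction (p := fun e' => f e = f e') rfl (fun e' h => h.trans (hf e').symm) e'

instance : Finite G.Face := inferInstanceAs (Finite (Quot _))

/-- The face whose boundary walk contains the dart `d`. -/
abbrev face (d : G.Dart) : G.Face := Quot.mk _ d

theorem face_faceStep (d : G.Dart) : G.face (G.faceStep d) = G.face d :=
  (Quot.sound (r := fun d d' : G.Dart => d' = G.faceStep d) rfl).symm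

theorem face_turn_true (p : G.Passage) : G.face (G.turn p true) = G.face (G.inEdge p, true) := by
  rw [← G.face_faceStep (G.inEdge p, true)]
  simp [faceStep]

theorem face_turn_false (p : G.Passage) : G.face (G.turn p false) = G.face (G.outEdge p, false) := by
  rw [← G.face_faceStep (G.outEdge p, false)]
  rfl

/-- The mod `2` coboundary from faces to edges: the sum of the values on both sides of an edge. -/
def faceCoboundary : (G.Face → ZMod 2) →ₗ[ZMod 2] (G.Edge → ZMod 2) where
  toFun f e := f (G.face (e, true)) + f (G.face (e, false))
  map_add' f g := by funext e; simp only [Pi.add_apply]; ring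
  map_smul' r f := by funext e; simp only [Pi.smul_apply, smul_eq_mul, RingHom.id_apply]; ring

/-- The mod `2` boundary from edges to crossings. -/
def edgeBoundary : (G.Edge → ZMod 2) →ₗ[ZMod 2] (Fin G.n → ZMod 2) where
  toFun z c := z (G.inEdge (some (c, true))) + z (G.outEdge (some (c, true)))
    + (z (G.inEdge (some (c, false))) + z (G.outEdge (some (c, false))))
  map_add' f g := by funext e; simp only [Pi.add_apply]; ring
  map_smul' r f := by funext e; simp only [Pi.smul_apply, smul_eq_mul, RingHom.id_apply]; ring

/-- The four face corners at a crossing, as equalities between the faces of the adjacent darts. -/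
theorem face_corners (c : Fin G.n) (o : Bool) :
    (if G.positive c = o then
      G.face (G.outEdge (some (c, !o)), true) = G.face (G.inEdge (some (c, o)), true) ∧
      G.face (G.inEdge (some (c, !o)), false) = G.face (G.outEdge (some (c, o)), false)
    else
      G.face (G.inEdge (some (c, !o)), false) = G.face (G.inEdge (some (c, o)), true) ∧
      G.face (G.outEdge (some (c, !o)), true) = G.face (G.outEdge (some (c, o)), false)) := by
  have h1 := G.face_turn_true (some (c, o))
  have h2 := G.face_turn_false (some (c, o))
  cases hp : G.positive c <;> cases o <;> simp_all [turn]

/-- The boundary of a face passes each crossing at whole corners. -/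
theorem edgeBoundary_faceCoboundary (f : G.Face → ZMod 2) :
    G.edgeBoundary (G.faceCoboundary f) = 0 := by
  funext c
  have h1 := G.face_corners c true
  have h2 := G.face_corners c false
  simp only [edgeBoundary, faceCoboundary, LinearMap.coe_mk, AddHom.coe_mk, Pi.zero_apply]
  cases hp : G.positive c <;> simp only [hp, if_true, Bool.not_true, Bool.not_false,
    Bool.false_eq_true, Bool.true_eq_false, if_false] at h1 h2 <;>
  · rw [h1.1, h1.2, h2.1, h2.2]
    generalize f _ = a, f _ = b, f _ = c, f _ = d
    have := CharTwo.add_self_eq_zero a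
    have := CharTwo.add_self_eq_zero b
    have := CharTwo.add_self_eq_zero c
    have := CharTwo.add_self_eq_zero d
    grind

/-- The kernel consists of the constants, since the diagram is connected. -/
theorem faceCoboundary_ker_le :
    LinearMap.ker G.faceCoboundary ≤ Submodule.span (ZMod 2) {fun _ => 1} := by
  intro f hf
  have hf' : ∀ e, f (G.face (e, true)) = f (G.face (e, false)) := fun e => by
    have := congrFun (LinearMap.mem_ker.1 hf) e
    simp only [faceCoboundary, LinearMap.coe_mk, AddHom.coe_mk, Pi.zero_apply] at this
    exact CharTwo.add_eq_zero.1 this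
  have hnext : ∀ e, f (G.face (G.next e, true)) = f (G.face (e, true)) := by
    intro e
    obtain ⟨p, rfl⟩ : ∃ p, e = G.inEdge p := ⟨G.next e, by simp⟩
    rw [show G.next (G.inEdge p) = G.outEdge p by simp]
    rcases p with _ | ⟨c, o⟩
    · have := G.face_turn_true none
      simp only [turn] at this
      rw [this]
    · have h1 := G.face_corners c true
      have h2 := G.face_corners c false
      cases hp : G.positive c <;> cases o <;> simp only [hp, if_true, Bool.not_true, Bool.not_false,
        Bool.false_eq_true, Bool.true_eq_false, if_false] at h1 h2 <;>
      grind
  refine Submodule.mem_span_singleton.2 ⟨f (G.face (none, true)), ?_⟩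
  funext x
  induction x using Quot.ind with
  | mk d =>
  have := G.const_of_next (fun e => f (G.face (e, true))) hnext d.1 none
  rcases d with ⟨e, _ | _⟩
  · exact (mul_one _).trans (this.symm.trans (hf' e))
  · exact (mul_one _).trans this.symm

/-- The base point is not counted as a vertex, so a chain of edges may end there; a functional that
kills all boundaries is constant along the knot, and zero at the base point. -/
theorem edgeBoundary_surjective : Function.Surjective G.edgeBoundary := by
  classical
  rw [← LinearMap.range_eq_top]
  by_contra hne
  obtain ⟨f, hf0, hf⟩ := Submodule.exists_le_ker_of_lt_top _ (lt_top_iff_ne_top.2 hne)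
  apply hf0
  have hfz : ∀ z, ∑ c, G.edgeBoundary z c * f (Pi.single c 1) = 0 := by
    intro z
    have h1 : f (G.edgeBoundary z) = 0 := hf (LinearMap.mem_range_self _ z)
    conv at h1 => lhs; rw [← (Finset.univ_sum_single (G.edgeBoundary z)), map_sum]
    rw [← h1]
    refine Finset.sum_congr rfl fun c _ => ?_
    rw [← smul_eq_mul, ← map_smul]
    congr 1
    rw [← Pi.single_smul, smul_eq_mul, mul_one]
  let y : G.Passage → ZMod 2 := fun p => p.elim 0 fun q => f (Pi.single q.1 1)
  have hy : ∀ e, y (G.next e) = y e := by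
    intro e
    have key : ∀ z : G.Edge → ZMod 2, ∑ p : G.Passage, y p * (z (G.inEdge p) + z (G.outEdge p)) = 0 := by
      intro z
      rw [← hfz z, Fintype.sum_option, Fintype.sum_prod_type]
      simp only [y, Option.elim, zero_mul, zero_add, edgeBoundary, LinearMap.coe_mk, AddHom.coe_mk,
        Fintype.sum_bool]
      exact Finset.sum_congr rfl fun c _ => by ring
    have := key (Pi.single e 1)
    simp only [mul_add, Finset.sum_add_distrib, Pi.single_apply, mul_ite, mul_one, mul_zero] at this
    rw [Finset.sum_ite_eq' Finset.univ e] at this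
    rw [Finset.sum_eq_single (G.next e)] at this
    · simp at this
      exact CharTwo.add_eq_zero.1 this
    · intro p _ hp
      rw [if_neg]
      rintro rfl
      simp at hp
    · simp
  have hy0 : ∀ p, y p = 0 := fun p => (G.const_of_next y hy p none).trans rfl
  refine LinearMap.pi_ext' fun c => LinearMap.ext_ring ?_
  have := hy0 (some (c, true))
  simpa [y] using this

/-- By the genus zero condition the image of `faceCoboundary` has dimension at least `n + 1`, which is
the dimension of the kernel of `edgeBoundary`.  That kernel contains the sum of all edges, because
every crossing has four of them.  A preimage is a checkerboard colouring of the faces. -/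
theorem exists_isAlternating (hG : Nat.card G.Face = G.n + 2) : ∃ κ, G.IsAlternating κ := by
  classical
  have := Fintype.ofFinite G.Face
  have hF : Module.finrank (ZMod 2) (G.Face → ZMod 2) = G.n + 2 := by
    rw [Module.finrank_fintype_fun_eq_card, ← Nat.card_eq_fintype_card, hG]
  have hE : Module.finrank (ZMod 2) (G.Edge → ZMod 2) = 2 * G.n + 1 := by
    rw [Module.finrank_fintype_fun_eq_card]; simp; ring
  have hV : Module.finrank (ZMod 2) (Fin G.n → ZMod 2) = G.n := by simp
  have h1 := LinearMap.finrank_range_add_finrank_ker G.faceCoboundary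
  have h2 := LinearMap.finrank_range_add_finrank_ker G.edgeBoundary
  rw [LinearMap.range_eq_top.2 G.edgeBoundary_surjective, finrank_top] at h2
  have h3 : Module.finrank (ZMod 2) (LinearMap.ker G.faceCoboundary) ≤ 1 :=
    (Submodule.finrank_mono G.faceCoboundary_ker_le).trans ((finrank_span_le_card _).trans (by simp))
  have hle : LinearMap.range G.faceCoboundary ≤ LinearMap.ker G.edgeBoundary := by
    rintro _ ⟨f, rfl⟩
    exact G.edgeBoundary_faceCoboundary f
  have heq := Submodule.eq_of_le_of_finrank_le hle (by omega)
  have hone : (fun _ => 1 : G.Edge → ZMod 2) ∈ LinearMap.range G.faceCoboundary := by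
    rw [heq, LinearMap.mem_ker]
    funext c
    simp only [edgeBoundary, LinearMap.coe_mk, AddHom.coe_mk, Pi.zero_apply]
    exact CharTwo.add_self_eq_zero _
  obtain ⟨f, hf⟩ := hone
  have hf' : ∀ e, f (G.face (e, true)) = f (G.face (e, false)) + 1 := fun e => by
    have := congrFun hf e
    simp only [faceCoboundary, LinearMap.coe_mk, AddHom.coe_mk] at this
    rw [← this]
    have := CharTwo.add_self_eq_zero (f (G.face (e, false)))
    grind
  have hdec : ∀ a b : ZMod 2, a = b + 1 → decide (a = 0) = !decide (b = 0) := by decide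
  have hne : ∀ e, decide (f (G.face (e, true)) = 0) = !decide (f (G.face (e, false)) = 0) :=
    fun e => hdec _ _ (hf' e)
  -- an edge gets the colour of the face of its dart in the direction of the knot
  refine ⟨fun e => decide (f (G.face (e, true)) = 0), ?_, ?_, ?_⟩
  · have := G.face_turn_true none
    simp only [turn] at this
    simp only [this]
  all_goals
    intro c o
    have h1 := G.face_corners c true
    have h2 := G.face_corners c false
    have e1 := hne (G.inEdge (some (c, true)))
    have e2 := hne (G.inEdge (some (c, false)))
    have e3 := hne (G.outEdge (some (c, true)))
    have e4 := hne (G.outEdge (some (c, false)))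
    cases hp : G.positive c <;> cases o <;> simp only [hp, if_true, Bool.not_true, Bool.not_false,
        Bool.false_eq_true, Bool.true_eq_false, if_false] at h1 h2 ⊢ <;>
      simp_all

end GaussDiagram

/-! ### Changing one smoothing merges two circles or splits one -/

/-- Composing a permutation with a transposition of two points joins their cycles or separates
them. -/
theorem sameCycle_mul_swap_iff {α : Type*} [Finite α] [DecidableEq α] (σ : Equiv.Perm α) {a b : α}
    (hab : a ≠ b) : (σ * Equiv.swap a b).SameCycle a b ↔ ¬ σ.SameCycle a b := by
  classical
  set τ := σ * Equiv.swap a b with hτ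
  -- the first return of `b` to the pair `{a, b}` under `σ`
  have hex : ∃ m, 0 < m ∧ ((σ ^ m) b = a ∨ (σ ^ m) b = b) :=
    ⟨orderOf σ, orderOf_pos σ, Or.inr (by rw [pow_orderOf_eq_one]; rfl)⟩
  obtain ⟨hm0, hm⟩ := Nat.find_spec hex
  have hmin := fun j (hj : j < Nat.find hex) => Nat.find_min hex hj
  set m := Nat.find hex
  have hpow : ∀ j, j < m → (τ ^ (j + 1)) a = (σ ^ (j + 1)) b := by
    intro j
    induction j with
    | zero => intro _; simp [hτ]
    | succ j ih =>
      intro hj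
      rw [pow_succ' τ, Equiv.Perm.mul_apply, ih (by omega), pow_succ' σ (j + 1),
        Equiv.Perm.mul_apply]
      have := hmin (j + 1) hj
      rw [Equiv.Perm.mul_apply, Equiv.swap_apply_of_ne_of_ne]
      · exact fun h => this ⟨by omega, Or.inl h⟩
      · exact fun h => this ⟨by omega, Or.inr h⟩
  have hpm : (τ ^ m) a = (σ ^ m) b := by
    have := hpow (m - 1) (by omega)
    rwa [Nat.sub_add_cancel hm0] at this
  rcases hm with hm | hm
  · have hσ : σ.SameCycle a b := Equiv.Perm.SameCycle.symm ⟨m, by simpa using hm⟩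
    refine iff_of_false ?_ (not_not_intro hσ)
    intro hc
    obtain ⟨k, hk⟩ := hc.exists_nat_pow_eq
    -- the `τ`-cycle of `a` closes up after `m` steps, before `b` is met
    have hfix : ∀ q r, (τ ^ (m * q + r)) a = (τ ^ r) a := by
      intro q r
      induction q with
      | zero => simp
      | succ q ih =>
        rw [show m * (q + 1) + r = (m * q + r) + m by ring, pow_add, Equiv.Perm.mul_apply, hpm, hm,
          ih]
    rw [← Nat.div_add_mod k m, hfix] at hk
    have hlt := Nat.mod_lt k hm0
    rcases Nat.eq_zero_or_pos (k % m) with h0 | h0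
    · rw [h0] at hk
      exact hab (by simpa using hk)
    · have := hpow (k % m - 1) (by omega)
      rw [Nat.sub_add_cancel h0, hk] at this
      exact hmin _ hlt ⟨h0, Or.inr this.symm⟩
  · refine iff_of_true ⟨m, by simpa [hm] using hpm⟩ ?_
    intro hc
    obtain ⟨k, hk⟩ := hc.symm.exists_nat_pow_eq
    have hfix : ∀ q r, (σ ^ (m * q + r)) b = (σ ^ r) b := by
      intro q r
      induction q with
      | zero => simp
      | succ q ih =>
        rw [show m * (q + 1) + r = (m * q + r) + m by ring, pow_add, Equiv.Perm.mul_apply, hm, ih]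
    rw [← Nat.div_add_mod k m, hfix] at hk
    rcases Nat.eq_zero_or_pos (k % m) with h0 | h0
    · rw [h0] at hk
      exact hab (by simpa using hk.symm)
    · exact hmin _ (Nat.mod_lt k hm0) ⟨h0, Or.inl hk⟩

namespace KnotDiagram

variable (D : KnotDiagram)

theorem exists_isAlternating : ∃ κ, D.IsAlternating κ :=
  D.toGaussDiagram.exists_isAlternating D.planar

variable {D}

/-- The vertex of the cube at the other end of the edge in direction `c`. -/
def flipAt (v : D.Vertex) (c : Fin D.n) : D.Vertex := Function.update v c (!v c)

@[simp] theorem flipAt_same (v : D.Vertex) (c : Fin D.n) : flipAt v c c = !v c := by simp [flipAt]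

theorem flipAt_ne (v : D.Vertex) {c c' : Fin D.n} (h : c' ≠ c) : flipAt v c c' = v c' := by
  simp [flipAt, h]

@[simp] theorem flipAt_flipAt (v : D.Vertex) (c : Fin D.n) : flipAt (flipAt v c) c = v := by
  simp [flipAt]

theorem flipAt_comm (v : D.Vertex) (c c' : Fin D.n) : flipAt (flipAt v c) c' = flipAt (flipAt v c') c := by
  funext j
  by_cases h1 : j = c <;> by_cases h2 : j = c'
  · subst h1; subst h2; rfl
  · subst h1; rw [flipAt_ne _ h2, flipAt_same, flipAt_same, flipAt_ne _ h2]
  · subst h2; rw [flipAt_same, flipAt_ne _ h1, flipAt_ne _ h1, flipAt_same]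
  · simp [flipAt_ne, h1, h2]

/-- One step along a circle of the resolution `v`, in the direction given by the source-sink
orientation `κ`. -/
def circleStep (κ : D.Edge → Bool) (v : D.Vertex) (e : D.Edge) : D.Edge :=
  match (if κ e then D.next e else e) with
  | none => if κ e then D.outEdge none else D.inEdge none
  | some (c, o) =>
      if (v c == !(D.positive c)) = κ e then D.outEdge (some (c, !o)) else D.inEdge (some (c, !o))

theorem circleStep_in {κ : D.Edge → Bool} (v : D.Vertex) {c o}
    (h : κ (D.inEdge (some (c, o))) = true) : circleStep κ v (D.inEdge (some (c, o))) =
      if v c = !(D.positive c) then D.outEdge (some (c, !o)) else D.inEdge (some (c, !o)) := by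
  simp only [circleStep, h, if_true, Equiv.apply_symm_apply, beq_iff_eq]

theorem circleStep_out {κ : D.Edge → Bool} (v : D.Vertex) {c o}
    (h : κ (D.outEdge (some (c, o))) = false) : circleStep κ v (D.outEdge (some (c, o))) =
      if v c = !(D.positive c) then D.inEdge (some (c, !o)) else D.outEdge (some (c, !o)) := by
  simp only [circleStep, h, Bool.false_eq_true, if_false]
  by_cases h' : v c = !(D.positive c) <;> simp [h']

theorem circleStep_in_none {κ : D.Edge → Bool} (v : D.Vertex)
    (h : κ (D.inEdge none) = true) : circleStep κ v (D.inEdge none) = D.outEdge none := by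
  simp only [circleStep, h, if_true, Equiv.apply_symm_apply]

theorem circleStep_out_none {κ : D.Edge → Bool} (v : D.Vertex)
    (h : κ (D.outEdge none) = false) : circleStep κ v (D.outEdge none) = D.inEdge none := by
  simp only [circleStep, h, if_false, Bool.false_eq_true]

/-- Every edge has a head with respect to `κ`. -/
theorem exists_head (κ : D.Edge → Bool) (e : D.Edge) :
    (∃ p, D.inEdge p = e ∧ κ (D.inEdge p) = true) ∨
      (∃ p, D.outEdge p = e ∧ κ (D.outEdge p) = false) := by
  cases h : κ e
  · exact Or.inr ⟨e, rfl, h⟩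
  · exact Or.inl ⟨D.next e, by simp, by simpa using h⟩

/-- Walking against the orientation is the inverse of walking along it. -/
theorem circleStep_not {κ : D.Edge → Bool} (hκ : D.IsAlternating κ) (v : D.Vertex) (e : D.Edge) :
    circleStep (fun e => !κ e) v (circleStep κ v e) = e := by
  have h1 := hκ.oriented
  have h2 := hκ.changes
  have h0 := hκ.base
  obtain ⟨p, rfl, hp⟩ | ⟨p, rfl, hp⟩ := exists_head κ e
  · rcases p with _ | ⟨c, o⟩
    · rw [circleStep_in_none v hp, circleStep_out_none v (by rw [← h0, hp]; rfl)]
    · rw [circleStep_in v hp]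
      split_ifs with h
      · rw [circleStep_out, if_pos h, Bool.not_not]
        rw [← h1, hp]; rfl
      · rw [circleStep_in, if_neg h, Bool.not_not]
        rw [h2, ← h1, hp]; rfl
  · rcases p with _ | ⟨c, o⟩
    · rw [circleStep_out_none v hp, circleStep_in_none v (by rw [h0, hp]; rfl)]
    · rw [circleStep_out v hp]
      have h3 := h1 c (!o)
      rw [Bool.not_not] at h3
      split_ifs with h
      · rw [circleStep_in, if_pos h, Bool.not_not]
        rw [h3, hp]; rfl
      · rw [circleStep_out, if_neg h, Bool.not_not]
        rw [show κ (D.outEdge (some (c, !o))) = _ from (Bool.not_not _).symm, ← h2, h3, hp]; rfl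

/-- The permutation of the edges whose cycles are the circles of the resolution `v`. -/
def circlePerm {κ : D.Edge → Bool} (hκ : D.IsAlternating κ) (v : D.Vertex) : Equiv.Perm D.Edge where
  toFun := circleStep κ v
  invFun := circleStep (fun e => !κ e) v
  left_inv := circleStep_not hκ v
  right_inv e := by simpa using circleStep_not hκ.not v e

theorem circlePerm_apply {κ : D.Edge → Bool} (hκ : D.IsAlternating κ) (v : D.Vertex) (e : D.Edge) :
    circlePerm hκ v e = circleStep κ v e := rfl

theorem circle_circleStep (κ : D.Edge → Bool) (v : D.Vertex) (e : D.Edge) :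
    D.circle v (circleStep κ v e) = D.circle v e := by
  obtain ⟨p, rfl, hp⟩ | ⟨p, rfl, hp⟩ := exists_head κ e
  · rcases p with _ | ⟨c, o⟩
    · rw [circleStep_in_none v hp]
      exact (Quot.sound Joined.base).symm
    · rw [circleStep_in v hp]
      split_ifs with h
      · exact (Quot.sound (Joined.oriented c o h)).symm
      · have h' : v c = D.positive c := by simpa using h
        cases o
        · exact Quot.sound (Joined.disoriented_in c h')
        · exact (Quot.sound (Joined.disoriented_in c h')).symm
  · rcases p with _ | ⟨c, o⟩
    · rw [circleStep_out_none v hp]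
      exact Quot.sound Joined.base
    · rw [circleStep_out v hp]
      split_ifs with h
      · have := Quot.sound (Joined.oriented c (!o) h)
        rwa [Bool.not_not] at this
      · have h' : v c = D.positive c := by simpa using h
        cases o
        · exact Quot.sound (Joined.disoriented_out c h')
        · exact (Quot.sound (Joined.disoriented_out c h')).symm

theorem circle_eq_iff_sameCycle {κ : D.Edge → Bool} (hκ : D.IsAlternating κ) (v : D.Vertex)
    (e f : D.Edge) : D.circle v e = D.circle v f ↔ (circlePerm hκ v).SameCycle e f := by
  constructor
  · intro h
    have step : ∀ e, (circlePerm hκ v).SameCycle e (circleStep κ v e) := fun e => ⟨1, by simp; rfl⟩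
    have h1 := hκ.oriented
    have h2 := hκ.changes
    have h0 := hκ.base
    rw [Quot.eq] at h
    refine (Equivalence.eqvGen_iff (Equiv.Perm.SameCycle.equivalence (circlePerm hκ v))).1
      (Relation.EqvGen.mono (r := D.Joined v) ?_ _ _ h)
    intro e f hef
    induction hef with
    | base =>
      cases hb : κ (D.outEdge none)
      · have := step (D.outEdge none)
        rw [circleStep_out_none v hb] at this
        exact this.symm
      · have := step (D.inEdge none)
        rwa [circleStep_in_none v (by rw [h0, hb])] at this
    | oriented c o hc =>
      cases hb : κ (D.inEdge (some (c, o)))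
      · have := step (D.outEdge (some (c, !o)))
        rw [circleStep_out v (by rw [← h1, hb]), if_pos hc, Bool.not_not] at this
        exact this.symm
      · have := step (D.inEdge (some (c, o)))
        rwa [circleStep_in v hb, if_pos hc] at this
    | disoriented_in c hc =>
      have hc' : v c ≠ !D.positive c := by simp [hc]
      cases hb : κ (D.inEdge (some (c, true)))
      · have := step (D.inEdge (some (c, false)))
        rw [circleStep_in v (by rw [h2, show false = !true from rfl, ← h1, hb]; rfl), if_neg hc'] at this
        exact this.symm
      · have := step (D.inEdge (some (c, true)))
        rwa [circleStep_in v hb, if_neg hc'] at this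
    | disoriented_out c hc =>
      have hc' : v c ≠ !D.positive c := by simp [hc]
      cases hb : κ (D.outEdge (some (c, true)))
      · have := step (D.outEdge (some (c, true)))
        rwa [circleStep_out v hb, if_neg hc'] at this
      · have := step (D.outEdge (some (c, false)))
        rw [circleStep_out v (by rw [show false = !true from rfl, ← h1, h2, hb]), if_neg hc'] at this
        exact this.symm
  · intro h
    obtain ⟨k, rfl⟩ := h.exists_nat_pow_eq
    clear h
    induction k with
    | zero => rfl
    | succ k ih =>
      rw [pow_succ', Equiv.Perm.mul_apply, circlePerm_apply, circle_circleStep, ih]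

/-- At `c` the two edges of the over-strand are the ones directed towards the crossing, and the two
smoothings differ in which of the outgoing edges follows which of them. -/
theorem circlePerm_flip {κ : D.Edge → Bool} (hκ : D.IsAlternating κ) (v : D.Vertex) (c : Fin D.n)
    (hc : κ (D.inEdge (some (c, true))) = true) :
    circlePerm hκ (flipAt v c) =
      circlePerm hκ v * Equiv.swap (D.inEdge (some (c, true))) (D.outEdge (some (c, true))) := by
  have hc2 : κ (D.outEdge (some (c, true))) = false := by
    rw [← Bool.not_not (κ (D.outEdge _)), ← hκ.changes, hc]; rfl
  have hc3 : κ (D.outEdge (some (c, false))) = true := (hκ.oriented c true).symm.trans hc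
  have hc4 : κ (D.inEdge (some (c, false))) = false := (hκ.oriented c false).trans hc2
  have key : ∀ a b : Bool, ((!a) = !b) ↔ ¬ (a = !b) := by decide
  ext1 e
  rw [Equiv.Perm.mul_apply]
  by_cases h1 : e = D.inEdge (some (c, true))
  · rw [h1, Equiv.swap_apply_left, circlePerm_apply, circlePerm_apply, circleStep_in _ hc,
      circleStep_out _ hc2, flipAt_same]
    simp only [key]
    split_ifs <;> rfl
  by_cases h2 : e = D.outEdge (some (c, true))
  · rw [h2, Equiv.swap_apply_right, circlePerm_apply, circlePerm_apply, circleStep_in _ hc,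
      circleStep_out _ hc2, flipAt_same]
    simp only [key]
    split_ifs <;> rfl
  rw [Equiv.swap_apply_of_ne_of_ne h1 h2, circlePerm_apply, circlePerm_apply]
  obtain ⟨p, rfl, hp⟩ | ⟨p, rfl, hp⟩ := exists_head κ e
  · rcases p with _ | ⟨c', o⟩
    · rw [circleStep_in_none _ hp, circleStep_in_none _ hp]
    · rw [circleStep_in _ hp, circleStep_in _ hp, flipAt_ne]
      rintro rfl
      cases o
      · rw [hp] at hc4; cases hc4
      · exact h1 rfl
  · rcases p with _ | ⟨c', o⟩
    · rw [circleStep_out_none _ hp, circleStep_out_none _ hp]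
    · rw [circleStep_out _ hp, circleStep_out _ hp, flipAt_ne]
      rintro rfl
      cases o
      · rw [hp] at hc3; cases hc3
      · exact h2 rfl

/-- Planarity excludes the bifurcation of one circle into one circle: the two strands at `c` lie on
one circle on exactly one side of an edge of the cube. -/
theorem circle_flip_eq_iff (v : D.Vertex) (c : Fin D.n) :
    D.circle (flipAt v c) (D.inEdge (some (c, true))) = D.circle (flipAt v c) (D.outEdge (some (c, true)))
      ↔ D.circle v (D.inEdge (some (c, true))) ≠ D.circle v (D.outEdge (some (c, true))) := by
  classical
  -- up to reversing the source-sink orientation, the over-strand is directed towards `c`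
  obtain ⟨κ, hκ, hc⟩ : ∃ κ, D.IsAlternating κ ∧ κ (D.inEdge (some (c, true))) = true := by
    obtain ⟨κ, hκ⟩ := D.exists_isAlternating
    cases h : κ (D.inEdge (some (c, true)))
    · exact ⟨_, hκ.not, by rw [h]; rfl⟩
    · exact ⟨κ, hκ, h⟩
  rw [circle_eq_iff_sameCycle hκ, circlePerm_flip hκ v c hc, ne_eq, circle_eq_iff_sameCycle hκ,
    sameCycle_mul_swap_iff]
  intro h
  have := hκ.changes c true
  rw [h] at this
  simp at this

/-! ### Circles away from a crossing -/

/-- The edge `e` lies on one of the circles of the resolution `v` that pass the crossing `c`. -/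
def Near (c : Fin D.n) (v : D.Vertex) (e : D.Edge) : Prop :=
  D.circle v e = D.circle v (D.inEdge (some (c, true))) ∨
    D.circle v e = D.circle v (D.outEdge (some (c, true)))

theorem near_in (c : Fin D.n) (v : D.Vertex) (o : Bool) : Near c v (D.inEdge (some (c, o))) := by
  cases o
  · by_cases h : v c = D.positive c
    · exact Or.inl (Quot.sound (Joined.disoriented_in c h)).symm
    · exact Or.inr (Quot.sound (Joined.oriented c false (Bool.eq_not.2 h)))
  · exact Or.inl rfl

theorem near_out (c : Fin D.n) (v : D.Vertex) (o : Bool) : Near c v (D.outEdge (some (c, o))) := by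
  cases o
  · by_cases h : v c = D.positive c
    · exact Or.inr (Quot.sound (Joined.disoriented_out c h)).symm
    · exact Or.inl (Quot.sound (Joined.oriented c true (Bool.eq_not.2 h))).symm
  · exact Or.inr rfl

/-- A connection of the resolution `v` is one of the resolution `flipAt v c`, or is located at `c`. -/
theorem Joined.flip_or {v : D.Vertex} {e f : D.Edge} (h : D.Joined v e f) (c : Fin D.n) :
    D.Joined (flipAt v c) e f ∨
      ((∃ o, e = D.inEdge (some (c, o)) ∨ e = D.outEdge (some (c, o))) ∧
       ∃ o, f = D.inEdge (some (c, o)) ∨ f = D.outEdge (some (c, o))) := by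
  induction h with
  | base => exact Or.inl Joined.base
  | oriented c' o hc =>
    by_cases h : c' = c
    · subst h; exact Or.inr ⟨⟨_, Or.inl rfl⟩, ⟨_, Or.inr rfl⟩⟩
    · exact Or.inl (Joined.oriented c' o (by rw [flipAt_ne _ h, hc]))
  | disoriented_in c' hc =>
    by_cases h : c' = c
    · subst h; exact Or.inr ⟨⟨_, Or.inl rfl⟩, ⟨_, Or.inl rfl⟩⟩
    · exact Or.inl (Joined.disoriented_in c' (by rw [flipAt_ne _ h, hc]))
  | disoriented_out c' hc =>
    by_cases h : c' = c
    · subst h; exact Or.inr ⟨⟨_, Or.inr rfl⟩, ⟨_, Or.inr rfl⟩⟩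
    · exact Or.inl (Joined.disoriented_out c' (by rw [flipAt_ne _ h, hc]))

theorem near_of_crossing {c : Fin D.n} (v : D.Vertex) {e : D.Edge}
    (h : ∃ o, e = D.inEdge (some (c, o)) ∨ e = D.outEdge (some (c, o))) : Near c v e := by
  obtain ⟨o, rfl | rfl⟩ := h
  · exact near_in c v o
  · exact near_out c v o

theorem near_congr {c : Fin D.n} {v : D.Vertex} {e f : D.Edge} (h : D.circle v e = D.circle v f) :
    Near c v e ↔ Near c v f := by
  simp only [Near, h]

/-- A function on edges that is constant on the strands of a resolution is constant on circles. -/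
theorem eq_of_circle_eq {α : Sort*} {v : D.Vertex} (g : D.Edge → α)
    (hg : ∀ e f, D.Joined v e f → g e = g f) {e f : D.Edge} (h : D.circle v e = D.circle v f) :
    g e = g f :=
  congrArg (Quot.lift g hg) h

theorem Near.flip {c : Fin D.n} {v : D.Vertex} {e : D.Edge} (h : Near c v e) :
    Near c (flipAt v c) e := by
  have inv : ∀ e f, D.Joined v e f → Near c (flipAt v c) e = Near c (flipAt v c) f := by
    intro e f hef
    rcases hef.flip_or c with h | ⟨h1, h2⟩
    · exact propext (near_congr (Quot.sound h))
    · exact propext (iff_of_true (near_of_crossing _ h1) (near_of_crossing _ h2))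
  rcases h with h | h
  · rw [eq_of_circle_eq _ inv h]; exact near_in _ _ _
  · rw [eq_of_circle_eq _ inv h]; exact near_out _ _ _

theorem near_flip_iff (c : Fin D.n) (v : D.Vertex) (e : D.Edge) : Near c (flipAt v c) e ↔ Near c v e :=
  ⟨fun h => by simpa using h.flip, Near.flip⟩

/-- Edges on one circle away from `c` stay on one circle. -/
theorem circle_flip_eq_of_not_near {c : Fin D.n} {v : D.Vertex} {e f : D.Edge} (hf : ¬ Near c v f)
    (h : D.circle v e = D.circle v f) : D.circle (flipAt v c) e = D.circle (flipAt v c) f := by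
  have inv : ∀ e e', D.Joined v e e' →
      (¬ Near c v e ∧ D.circle (flipAt v c) e = D.circle (flipAt v c) f) =
      (¬ Near c v e' ∧ D.circle (flipAt v c) e' = D.circle (flipAt v c) f) := by
    intro e e' hee
    rcases hee.flip_or c with h | ⟨h1, h2⟩
    · rw [show D.circle (flipAt v c) e = D.circle (flipAt v c) e' from Quot.sound h,
        propext (near_congr (c := c) (Quot.sound hee))]
    · exact propext (iff_of_false (fun h => h.1 (near_of_crossing _ h1))
        (fun h => h.1 (near_of_crossing _ h2)))
  have := eq_of_circle_eq _ inv h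
  exact (this.mpr ⟨hf, rfl⟩).2

theorem circle_out {v : D.Vertex} (k : D.Circle v) : D.circle v (Quot.out k) = k := Quot.out_eq k

/-- The circles of `v` that do not pass the crossing `c`. -/
def awayCircles (v : D.Vertex) (c : Fin D.n) : Finset (D.Circle v) :=
  {D.circle v (D.inEdge (some (c, true))), D.circle v (D.outEdge (some (c, true)))}ᶜ

theorem mem_awayCircles {v : D.Vertex} {c : Fin D.n} {e : D.Edge} :
    D.circle v e ∈ awayCircles v c ↔ ¬ Near c v e := by
  simp [awayCircles, Near]

/-- The circles that do not pass the crossing `c` are the same in both resolutions. -/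
@[to_additive]
theorem prod_awayCircles_flip {M : Type*} [CommMonoid M] (v : D.Vertex) (c : Fin D.n)
    (g : D.Circle v → M) (g' : D.Circle (flipAt v c) → M)
    (h : ∀ e, ¬ Near c v e → g (D.circle v e) = g' (D.circle (flipAt v c) e)) :
    ∏ k ∈ awayCircles v c, g k = ∏ k ∈ awayCircles (flipAt v c) c, g' k := by
  have mem : ∀ {v : D.Vertex} {k : D.Circle v}, k ∈ awayCircles v c → ¬ Near c v (Quot.out k) := by
    intro v k hk
    rwa [← circle_out k, mem_awayCircles] at hk
  refine Finset.prod_bij' (fun k _ => D.circle (flipAt v c) (Quot.out k))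
    (fun k _ => D.circle v (Quot.out k)) ?_ ?_ ?_ ?_ ?_
  · intro k hk
    rw [mem_awayCircles, near_flip_iff]
    exact mem hk
  · intro k hk
    rw [mem_awayCircles, ← near_flip_iff]
    exact mem hk
  · intro k hk
    have := circle_flip_eq_of_not_near (c := c) (v := flipAt v c)
      (by rw [near_flip_iff]; exact mem hk) (circle_out (D.circle (flipAt v c) (Quot.out k)))
    rw [flipAt_flipAt] at this
    rw [this, circle_out]
  · intro k hk
    rw [circle_flip_eq_of_not_near (by rw [← near_flip_iff]; exact mem hk)
      (circle_out (D.circle v (Quot.out k))), circle_out]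
  · intro k hk
    rw [← h _ (mem hk), circle_out]

/-- A product over all circles: the circles at `c` are one or two. -/
@[to_additive]
theorem prod_circles_eq {M : Type*} [CommMonoid M] (v : D.Vertex) (c : Fin D.n)
    (g : D.Circle v → M) :
    ∏ k, g k = (if D.circle v (D.inEdge (some (c, true))) = D.circle v (D.outEdge (some (c, true)))
      then g (D.circle v (D.inEdge (some (c, true))))
      else g (D.circle v (D.inEdge (some (c, true)))) * g (D.circle v (D.outEdge (some (c, true)))))
      * ∏ k ∈ awayCircles v c, g k := by
  rw [← Finset.prod_mul_prod_compl (awayCircles v c)ᶜ g, compl_compl, awayCircles, compl_compl]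
  congr 1
  split_ifs with h
  · rw [h]; simp
  · exact Finset.prod_pair h

end KnotDiagram

/-! ### Evaluating chains on coloured resolutions -/

open Label KnotDiagram

variable (F : Type*) [Field F] {D : KnotDiagram}

/-- The two ring homomorphisms `A → F[h]` over `F[h]`: `X ↦ h` for the colour `true`, and `X ↦ 0`
for the colour `false`. -/
def evalCoeff : Bool → Label → F[X]
  | _, one => 1
  | true, X => h F
  | false, X => 0

/-- The value of the handle element `2 X - h` at the two colours. -/
def handleValue (b : Bool) : F[X] := if b then h F else - h F

/-- The colouring `κ` of the edges is constant along the circles of the resolution `v`. -/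
def Compatible (v : D.Vertex) (κ : D.Edge → Bool) : Prop :=
  ∀ e f, D.Joined v e f → κ e = κ f

variable {F}

theorem Compatible.eq_of_circle_eq {v : D.Vertex} {κ : D.Edge → Bool} (hκ : Compatible v κ)
    {e f : D.Edge} (h : D.circle v e = D.circle v f) : κ e = κ f :=
  KnotDiagram.eq_of_circle_eq κ hκ h

theorem Compatible.out {v : D.Vertex} {κ : D.Edge → Bool} (hκ : Compatible v κ) (e : D.Edge) :
    κ (Quot.out (D.circle v e)) = κ e :=
  hκ.eq_of_circle_eq (circle_out _)

theorem Compatible.not {v : D.Vertex} {κ : D.Edge → Bool} (hκ : Compatible v κ) :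
    Compatible v fun e => !κ e := fun e f hef => congrArg (!·) (hκ e f hef)

variable (F)

/-- The weight of a labelled resolution in `colorEval`. -/
def stateWeight (v : D.Vertex) (κ : D.Edge → Bool) (l : D.Circle v → Label) : F[X] :=
  ∏ k, evalCoeff F (κ (Quot.out k)) (l k)

variable {F}

/-- The evaluation of a chain at the resolution `v` whose circles are coloured by `κ`: on the summand
`A ^ ⊗ (circles of v)` it is the tensor product of the evaluations `A → F[h]` given by the colours.
If `κ` is not constant on a circle, the colour of an arbitrary edge of it is used. -/
def colorEval (v : D.Vertex) (κ : D.Edge → Bool) : Chain F D →ₗ[F[X]] F[X] :=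
  ∑ l : D.Circle v → Label, stateWeight F v κ l • LinearMap.proj ⟨v, l⟩

theorem colorEval_apply (v : D.Vertex) (κ : D.Edge → Bool) (x : Chain F D) :
    colorEval v κ x = ∑ l, stateWeight F v κ l * x ⟨v, l⟩ := by
  simp [colorEval]

theorem sum_prod_label {K R : Type*} [Fintype K] [DecidableEq K] [CommSemiring R]
    {L : Type*} [Fintype L] (f : K → L → R) : ∑ l : K → L, ∏ k, f k (l k) = ∏ k, ∑ a, f k a := by
  rw [Finset.prod_univ_sum, Fintype.piFinset_univ]

/-- Coefficients of the inverse, up to the factor `h`, of the matrix `evalCoeff`. -/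
def invCoeff (F : Type*) [Field F] : Label → Bool → F[X]
  | one, true => 0
  | one, false => h F
  | X, true => 1
  | X, false => -1

theorem sum_invCoeff_mul_evalCoeff (a b : Label) :
    ∑ c, invCoeff F a c * evalCoeff F c b = if a = b then h F else 0 := by
  cases a <;> cases b <;> simp [invCoeff, evalCoeff]

/-- The labels are recovered, up to a power of `h`, from the evaluations at all colourings. -/
theorem h_pow_mul_apply (x : Chain F D) (v : D.Vertex) (l : D.Circle v → Label) :
    h F ^ Fintype.card (D.Circle v) * x ⟨v, l⟩ =
      ∑ κ : D.Circle v → Bool, (∏ k, invCoeff F (l k) (κ k)) *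
        colorEval v (fun e => κ (D.circle v e)) x := by
  simp_rw [colorEval_apply, stateWeight, circle_out, Finset.mul_sum, ← mul_assoc,
    ← Finset.prod_mul_distrib]
  rw [Finset.sum_comm]
  simp_rw [← Finset.sum_mul]
  have key (b : D.Circle v → Label) :
      ∑ κ : D.Circle v → Bool, ∏ k, invCoeff F (l k) (κ k) * evalCoeff F (κ k) (b k) =
        if l = b then h F ^ Fintype.card (D.Circle v) else 0 := by
    rw [sum_prod_label fun k c => invCoeff F (l k) c * evalCoeff F c (b k)]
    simp_rw [sum_invCoeff_mul_evalCoeff]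
    split_ifs with hlb
    · subst hlb; simp
    · obtain ⟨k, hk⟩ := Function.ne_iff.1 hlb
      exact Finset.prod_eq_zero (Finset.mem_univ k) (if_neg hk)
  simp_rw [key, ite_mul, zero_mul]
  simp

/-- A chain is determined by its evaluations at coloured resolutions. -/
theorem chain_ext {x y : Chain F D}
    (hxy : ∀ v κ, Compatible v κ → colorEval v κ x = colorEval v κ y) : x = y := by
  funext s
  obtain ⟨v, l⟩ := s
  have := h_pow_mul_apply x v l
  have h2 := h_pow_mul_apply y v l
  refine mul_left_cancel₀ (pow_ne_zero (Fintype.card (D.Circle v)) Polynomial.X_ne_zero)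
    (this.trans (Eq.trans ?_ h2.symm))
  refine Finset.sum_congr rfl fun κ _ => ?_
  rw [hxy]
  intro e f hef
  exact congrArg κ (Quot.sound hef)

/-! ### The signed involution on coloured resolutions -/

theorem hatSigma_apply (x : Chain F D) (v : D.Vertex) (t : D.Circle v → Label) :
    hatSigma x ⟨v, t⟩ =
      ∑ l, (∏ k, sigmaCoeff F (l k) (t k)) * (x ⟨v, l⟩).comp (- h F) := rfl

theorem colorEval_hatSigma (v : D.Vertex) (κ : D.Edge → Bool) (x : Chain F D) :
    colorEval v κ (hatSigma x) = (colorEval v (fun e => !κ e) x).comp (- h F) := by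
  have key : ∀ (b : Bool) (a : Label), ∑ y, evalCoeff F b y * sigmaCoeff F a y =
      (evalCoeff F (!b) a).comp (- h F) := by
    intro b a
    rw [show (Finset.univ : Finset Label) = {one, X} from rfl]
    cases b <;> cases a <;> simp [evalCoeff, sigmaCoeff]
  simp_rw [colorEval_apply, hatSigma_apply, stateWeight, Finset.mul_sum, ← mul_assoc,
    ← Finset.prod_mul_distrib]
  rw [Finset.sum_comm]
  simp_rw [← Finset.sum_mul]
  rw [Polynomial.sum_comp]
  refine Finset.sum_congr rfl fun l _ => ?_
  rw [sum_prod_label fun k y => evalCoeff F (κ (Quot.out k)) y * sigmaCoeff F (l k) y]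
  simp_rw [key]
  rw [Polynomial.mul_comp, Polynomial.prod_comp]

theorem h_mul_colorEval_hatNu (v : D.Vertex) (κ : D.Edge → Bool) (x : Chain F D) :
    h F * colorEval v κ (hatNu x) =
      colorEval v κ x - (colorEval v (fun e => !κ e) x).comp (- h F) := by
  rw [← colorEval_hatSigma, ← map_sub, ← h_smul_hatNu, map_smul, smul_eq_mul]

/-! ### Multiplication by `X` at an edge -/

/-- Multiplication by `X` on the tensor factor of the circle through the edge `e`. -/
def mulX (e : D.Edge) : Chain F D →ₗ[F[X]] Chain F D where
  toFun x s := if s.2 (D.circle s.1 e) = X then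
    x ⟨s.1, Function.update s.2 (D.circle s.1 e) one⟩ + h F * x s else 0
  map_add' x y := by
    funext s
    simp only [Pi.add_apply]
    split_ifs <;> ring
  map_smul' r x := by
    funext s
    simp only [Pi.smul_apply, smul_eq_mul, RingHom.id_apply]
    split_ifs <;> ring

theorem stateWeight_update (v : D.Vertex) (κ : D.Edge → Bool) (l : D.Circle v → Label)
    (k : D.Circle v) (a : Label) : stateWeight F v κ (Function.update l k a) =
      evalCoeff F (κ (Quot.out k)) a *
        ∏ k' ∈ Finset.univ.erase k, evalCoeff F (κ (Quot.out k')) (l k') := by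
  rw [stateWeight, ← Finset.mul_prod_erase _ _ (Finset.mem_univ k), Function.update_self]
  congr 1
  refine Finset.prod_congr rfl fun k' hk' => ?_
  rw [Function.update_of_ne (Finset.ne_of_mem_erase hk')]

/-- A sum over labellings, grouped by the label on one circle. -/
theorem sum_update {K L M : Type*} [Fintype K] [DecidableEq K] [Fintype L]
    [DecidableEq L] [AddCommMonoid M]
    (k : K) (a : L) (G : (K → L) → M) :
    ∑ l, G l = ∑ l : K → L, if l k = a then ∑ b, G (Function.update l k b) else 0 := by
  classical
  rw [← Finset.sum_filter, Finset.sum_sigma']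
  symm
  refine Finset.sum_bij' (fun p _ => Function.update p.1 k p.2)
    (fun l _ => ⟨Function.update l k a, l k⟩) ?_ ?_ ?_ ?_ ?_
  · simp
  · simp
  · rintro ⟨l, b⟩ hl
    simp only [Finset.mem_sigma, Finset.mem_filter, Finset.mem_univ, true_and, and_true] at hl
    simp [← hl]
  · simp
  · simp

theorem colorEval_mulX {v : D.Vertex} {κ : D.Edge → Bool} (hκ : Compatible v κ) (e : D.Edge)
    (x : Chain F D) : colorEval v κ (mulX e x) = (if κ e then h F else 0) * colorEval v κ x := by
  rw [colorEval_apply, colorEval_apply, sum_update (D.circle v e) one,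
    sum_update (D.circle v e) one (fun l => stateWeight F v κ l * x ⟨v, l⟩), Finset.mul_sum]
  refine Finset.sum_congr rfl fun l _ => ?_
  rw [mul_ite, mul_zero]
  split_ifs with h1 h2
  · rw [show (Finset.univ : Finset Label) = {one, X} from rfl, Finset.sum_pair (by decide),
      Finset.sum_pair (by decide)]
    simp only [stateWeight_update, hκ.out, mulX, LinearMap.coe_mk, AddHom.coe_mk,
      Function.update_self, Function.update_idem, if_true, reduceCtorEq, if_false, h2, evalCoeff]
    ring
  · rw [show (Finset.univ : Finset Label) = {one, X} from rfl, Finset.sum_pair (by decide),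
      Finset.sum_pair (by decide)]
    simp only [stateWeight_update, hκ.out, mulX, LinearMap.coe_mk, AddHom.coe_mk,
      Function.update_self, Function.update_idem, if_true, reduceCtorEq, if_false, h2, evalCoeff]
    ring
  · rfl

/-- Multiplication by `X` (`b = true`) or by `h - X` (`b = false`) at the edge `e`: on coloured
resolutions it is multiplication by `h` if `e` has the colour `b`, and `0` otherwise. -/
def colorProj (e : D.Edge) (b : Bool) : Chain F D →ₗ[F[X]] Chain F D :=
  if b then mulX e else h F • LinearMap.id - mulX e

theorem colorEval_colorProj {v : D.Vertex} {κ : D.Edge → Bool} (hκ : Compatible v κ) (e : D.Edge)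
    (b : Bool) (x : Chain F D) :
    colorEval v κ (colorProj e b x) = if κ e = b then h F * colorEval v κ x else 0 := by
  cases b <;> cases h : κ e <;> simp [colorProj, colorEval_mulX hκ, h]

/-! ### The reduced complexes on coloured resolutions -/

variable (F D)

/-- The chains that vanish on all coloured resolutions in which the base point has the colour `!b`. -/
def baseColor (b : Bool) : Submodule F[X] (Chain F D) where
  carrier := {x | ∀ v κ, Compatible v κ → κ (D.outEdge none) = !b → colorEval v κ x = 0}
  add_mem' hx hy v κ hκ hb := by rw [map_add, hx v κ hκ hb, hy v κ hκ hb, add_zero]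
  zero_mem' v κ hκ hb := map_zero _
  smul_mem' r x hx v κ hκ hb := by rw [map_smul, hx v κ hκ hb, smul_zero]

variable {F D}

theorem mem_baseColor_iff_colorProj {b : Bool} {x : Chain F D} :
    x ∈ baseColor F D b ↔ colorProj (D.outEdge none) (!b) x = 0 := by
  constructor
  · intro hx
    refine chain_ext fun v κ hκ => ?_
    rw [colorEval_colorProj hκ, map_zero]
    split_ifs with h
    · rw [hx v κ hκ h, mul_zero]
    · rfl
  · intro hx v κ hκ hb
    have := colorEval_colorProj hκ (D.outEdge none) (!b) x
    rw [hx, map_zero, if_pos hb] at this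
    exact (mul_eq_zero.1 this.symm).resolve_left Polynomial.X_ne_zero

theorem stateChain_apply (v : D.Vertex) (l : D.Circle v → Label) (s : D.State) :
    letI := Classical.decEq D.State
    stateChain F D v l s = if s = ⟨v, l⟩ then 1 else 0 := by
  simp only [stateChain, Pi.single_apply]

theorem colorEval_stateChain (v v' : D.Vertex) (κ : D.Edge → Bool) (l : D.Circle v → Label) :
    colorEval v' κ (stateChain F D v l) = if v' = v then stateWeight F v κ l else 0 := by
  rw [colorEval_apply]
  simp only [stateChain_apply, mul_ite, mul_one, mul_zero]
  split_ifs with hv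
  · subst hv
    rw [Finset.sum_eq_single l]
    · simp
    · intro l' _ hl
      rw [if_neg]
      intro heq
      exact hl (by simpa using heq)
    · simp
  · refine Finset.sum_eq_zero fun l' _ => if_neg ?_
    intro heq
    exact hv (congrArg Sigma.fst heq)

theorem chain_eq_sum (x : Chain F D) : x = ∑ s : D.State, x s • stateChain F D s.1 s.2 := by
  funext t
  rw [Finset.sum_apply]
  simp only [Pi.smul_apply, stateChain_apply, smul_eq_mul, mul_ite, mul_one, mul_zero]
  rw [Finset.sum_eq_single t]
  · simp
  · intro s _ hs
    rw [if_neg (fun h => hs h.symm)]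
  · simp

theorem complexX_eq : complexX F D = baseColor F D true := by
  apply le_antisymm
  · refine Submodule.span_le.2 ?_
    rintro _ ⟨v, l, rfl⟩ v' κ hκ hb
    rw [colorEval_stateChain]
    split_ifs with h
    · subst h
      rw [stateWeight_update, hκ.out, hb, Bool.not_true, evalCoeff, zero_mul]
    · rfl
  · intro x hx
    have hx' := mem_baseColor_iff_colorProj.1 hx
    rw [chain_eq_sum x]
    refine Submodule.sum_mem _ fun s _ => ?_
    cases hs : s.2 (baseCircle D s.1)
    · have := congrFun hx' s
      simp only [colorProj, mulX, Bool.not_true, Bool.false_eq_true, if_false, LinearMap.sub_apply,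
        LinearMap.smul_apply, LinearMap.id_apply, Pi.sub_apply, Pi.smul_apply, smul_eq_mul,
        Pi.zero_apply, LinearMap.coe_mk, AddHom.coe_mk] at this
      rw [if_neg (by rw [hs]; decide), sub_zero] at this
      rw [(mul_eq_zero.1 this).resolve_left Polynomial.X_ne_zero, zero_smul]
      exact zero_mem _
    · refine Submodule.smul_mem _ _ (Submodule.subset_span ⟨s.1, s.2, ?_⟩)
      rw [← hs, Function.update_eq_self]

theorem complexY_eq : complexY F D = baseColor F D false := by
  have gen : ∀ (v : D.Vertex) (l : D.Circle v → Label),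
      stateChain F D v (Function.update l (baseCircle D v) X)
        - h F • stateChain F D v (Function.update l (baseCircle D v) one) ∈ baseColor F D false := by
    intro v l v' κ hκ hb
    rw [map_sub, map_smul, colorEval_stateChain, colorEval_stateChain]
    split_ifs with h
    · subst h
      rw [stateWeight_update, stateWeight_update, hκ.out, hb, Bool.not_false, evalCoeff, evalCoeff,
        one_mul, smul_eq_mul, sub_self]
    · simp
  apply le_antisymm
  · refine Submodule.span_le.2 ?_
    rintro _ ⟨v, l, rfl⟩
    exact gen v l
  · intro x hx
    have hx' := mem_baseColor_iff_colorProj.1 hx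
    -- the generators account for all coefficients of states with label `X` at the base point, and
    -- the other coefficients are determined by them
    have hsum : x = ∑ s : D.State, if s.2 (baseCircle D s.1) = X then
        x s • (stateChain F D s.1 (Function.update s.2 (baseCircle D s.1) X)
        - h F • stateChain F D s.1 (Function.update s.2 (baseCircle D s.1) one)) else 0 := by
      have hcoef : ∀ s : D.State, s.2 (baseCircle D s.1) = X →
          x ⟨s.1, Function.update s.2 (baseCircle D s.1) one⟩ = - (h F * x s) := by
        intro s hs
        have := congrFun hx' s
        simp only [colorProj, mulX, Bool.not_false, if_true, LinearMap.coe_mk, AddHom.coe_mk,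
          Pi.zero_apply] at this
        rw [if_pos hs] at this
        exact eq_neg_of_add_eq_zero_left this
      conv_lhs => rw [chain_eq_sum x]
      rw [Fintype.sum_sigma, Fintype.sum_sigma]
      refine Finset.sum_congr rfl fun v _ => ?_
      rw [sum_update (baseCircle D v) X,
        sum_update (baseCircle D v) X (fun l => if l (baseCircle D v) = X then
        x ⟨v, l⟩ • (stateChain F D v (Function.update l (baseCircle D v) X)
        - h F • stateChain F D v (Function.update l (baseCircle D v) one)) else 0)]
      refine Finset.sum_congr rfl fun l _ => ?_
      split_ifs with hl
      · rw [show (Finset.univ : Finset Label) = {one, X} from rfl, Finset.sum_pair (by decide),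
          Finset.sum_pair (by decide)]
        have hup : Function.update l (baseCircle D v) X = l := by rw [← hl, Function.update_eq_self]
        simp only [Function.update_self, Function.update_idem, if_true, reduceCtorEq, if_false, hup,
          zero_add]
        rw [hcoef ⟨v, l⟩ hl]
        rw [smul_sub, smul_smul, mul_comm, neg_smul, sub_eq_add_neg, add_comm]
      · rfl
    rw [hsum]
    refine Submodule.sum_mem _ fun s _ => ?_
    split_ifs with hs
    · exact Submodule.smul_mem _ _ (Submodule.subset_span ⟨s.1, s.2, rfl⟩)
    · exact zero_mem _

/-! ### The edge maps of the cube on coloured resolutions -/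

theorem Compatible.eq_of_near {v : D.Vertex} {κ : D.Edge → Bool} (hκ : Compatible v κ) {c : Fin D.n}
    (hc : κ (D.inEdge (some (c, true))) = κ (D.outEdge (some (c, true)))) {e : D.Edge}
    (he : Near c v e) : κ e = κ (D.inEdge (some (c, true))) := by
  rcases he with h | h
  · exact hκ.eq_of_circle_eq h
  · exact (hκ.eq_of_circle_eq h).trans hc.symm

/-- Both smoothings of a crossing are compatible with a colouring exactly if the colour does not
change there. -/
theorem Compatible.flip_iff {v : D.Vertex} {κ : D.Edge → Bool} (hκ : Compatible v κ) (c : Fin D.n) :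
    Compatible (flipAt v c) κ ↔ κ (D.inEdge (some (c, true))) = κ (D.outEdge (some (c, true))) := by
  constructor
  · intro h
    by_cases hc : D.circle v (D.inEdge (some (c, true))) = D.circle v (D.outEdge (some (c, true)))
    · exact hκ.eq_of_circle_eq hc
    · exact h.eq_of_circle_eq ((circle_flip_eq_iff v c).2 hc)
  · intro hc e f hef
    rcases hef.flip_or c with h | ⟨h1, h2⟩
    · rw [flipAt_flipAt] at h
      exact hκ e f h
    · rw [hκ.eq_of_near hc (near_of_crossing v h1), hκ.eq_of_near hc (near_of_crossing v h2)]

/-- The colours of the two edges of the over-strand are, in some order, those of the under-strand. -/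
theorem Compatible.strand {v : D.Vertex} {κ : D.Edge → Bool} (hκ : Compatible v κ) (c : Fin D.n) :
    (κ (D.inEdge (some (c, true))) = κ (D.inEdge (some (c, false))) ∧
      κ (D.outEdge (some (c, true))) = κ (D.outEdge (some (c, false)))) ∨
    (κ (D.inEdge (some (c, true))) = κ (D.outEdge (some (c, false))) ∧
      κ (D.outEdge (some (c, true))) = κ (D.inEdge (some (c, false)))) := by
  by_cases h : v c = D.positive c
  · exact Or.inl ⟨hκ _ _ (Joined.disoriented_in c h), hκ _ _ (Joined.disoriented_out c h)⟩
  · exact Or.inr ⟨hκ _ _ (Joined.oriented c true (Bool.eq_not.2 h)),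
      (hκ _ _ (Joined.oriented c false (Bool.eq_not.2 h))).symm⟩

variable (F) in
/-- The factor by which the edge map at `c` that leaves the resolution `v` acts on a colouring: `1`
for a merge, and the value of the handle element for a split. -/
def bifurcationFactor (v : D.Vertex) (c : Fin D.n) (κ : D.Edge → Bool) : F[X] :=
  open Classical in
  if D.circle v (D.inEdge (some (c, true))) = D.circle v (D.outEdge (some (c, true))) then
    handleValue F (κ (D.inEdge (some (c, true)))) else 1

theorem sum_eq_sum_update_one {K L M : Type*} [Fintype K] [DecidableEq K] [Fintype L]
    [DecidableEq L] [AddCommMonoid M] (p : K) (t : K → L) (G : (K → L) → M) :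
    (∑ l, if ∀ k, k ≠ p → l k = t k then G l else 0) = ∑ y, G (Function.update t p y) := by
  rw [sum_update p (t p), Finset.sum_eq_single t]
  · rw [if_pos rfl]
    refine Finset.sum_congr rfl fun y _ => if_pos fun k hk => Function.update_of_ne hk _ _
  · intro l _ hl
    split_ifs with h
    · refine Finset.sum_eq_zero fun y _ => if_neg fun h' => hl ?_
      funext k
      by_cases hk : k = p
      · rw [hk, h]
      · rw [← h' k hk, Function.update_of_ne hk]
    · rfl
  · simp

theorem sum_eq_sum_update_two {K L M : Type*} [Fintype K] [DecidableEq K] [Fintype L]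
    [DecidableEq L] [AddCommMonoid M] {p q : K} (hpq : p ≠ q) (t : K → L) (G : (K → L) → M) :
    (∑ l, if ∀ k, k ≠ p → k ≠ q → l k = t k then G l else 0) =
      ∑ y, ∑ z, G (Function.update (Function.update t p y) q z) := by
  rw [sum_update q (t q), ← sum_eq_sum_update_one p t fun l => ∑ z, G (Function.update l q z)]
  refine Finset.sum_congr rfl fun l _ => ?_
  by_cases hl : ∀ k, k ≠ p → l k = t k
  · rw [if_pos hl, if_pos (hl q hpq.symm)]
    refine Finset.sum_congr rfl fun z _ => if_pos fun k hk hk' => ?_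
    rw [Function.update_of_ne hk', hl k hk]
  · rw [if_neg hl]
    split_ifs with hq
    · refine Finset.sum_eq_zero fun z _ => if_neg fun h' => hl fun k hk => ?_
      by_cases hkq : k = q
      · rw [hkq, hq]
      · rw [← h' k hk hkq, Function.update_of_ne hkq]
    · rfl

theorem univ_label : (Finset.univ : Finset Label) = {one, X} := rfl

theorem sum_evalCoeff_mulCoeff (b : Bool) (x y : Label) :
    ∑ z, evalCoeff F b z * mulCoeff F x y z = evalCoeff F b x * evalCoeff F b y := by
  rw [univ_label, Finset.sum_pair (by decide)]
  cases b <;> cases x <;> cases y <;> simp [evalCoeff, mulCoeff]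

theorem sum_evalCoeff_comulCoeff (b b' : Bool) (x : Label) :
    ∑ y, ∑ z, evalCoeff F b y * evalCoeff F b' z * comulCoeff F x y z =
      if b = b' then handleValue F b * evalCoeff F b x else 0 := by
  rw [univ_label, Finset.sum_pair (by decide), Finset.sum_pair (by decide),
    Finset.sum_pair (by decide)]
  cases b <;> cases b' <;> cases x <;> simp [evalCoeff, comulCoeff, handleValue]

/-- The transpose of an edge map on the weights of a coloured resolution. -/
theorem sum_stateWeight_edgeCoeff (v : D.Vertex) (c : Fin D.n) {κ : D.Edge → Bool}
    (hκ : Compatible (flipAt v c) κ) (l : D.Circle v → Label) :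
    ∑ l', stateWeight F (flipAt v c) κ l' * edgeCoeff F D c ⟨v, l⟩ ⟨flipAt v c, l'⟩ =
      open Classical in
      if Compatible v κ then bifurcationFactor F v c κ * stateWeight F v κ l else 0 := by
  classical
  have hflip := hκ.flip_iff c
  rw [flipAt_flipAt] at hflip
  -- `t` carries the labels of `l` over to the circles away from `c`
  let t : D.Circle (flipAt v c) → Label := fun k => l (D.circle v (Quot.out k))
  have ht : ∀ e, ¬ Near c v e → t (D.circle (flipAt v c) e) = l (D.circle v e) := by
    intro e he
    have := circle_flip_eq_of_not_near (c := c) (v := flipAt v c) (by rwa [near_flip_iff])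
      (circle_out (D.circle (flipAt v c) e))
    rw [flipAt_flipAt] at this
    exact congrArg l this
  have hcond : ∀ l' : D.Circle (flipAt v c) → Label,
      (∀ e, D.circle v e ≠ D.circle v (D.inEdge (some (c, true))) →
        D.circle v e ≠ D.circle v (D.outEdge (some (c, true))) →
        l' (D.circle (flipAt v c) e) = l (D.circle v e)) ↔
      ∀ k, k ≠ D.circle (flipAt v c) (D.inEdge (some (c, true))) →
        k ≠ D.circle (flipAt v c) (D.outEdge (some (c, true))) → l' k = t k := by
    intro l'
    have hnear : ∀ e, ¬ Near c v e ↔ ¬ Near c (flipAt v c) e := fun e => by rw [near_flip_iff]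
    simp only [Near, not_or] at hnear
    constructor
    · intro h k h1 h2
      rw [← circle_out k] at h1 h2
      obtain ⟨h3, h4⟩ := (hnear _).2 ⟨h1, h2⟩
      have := h _ h3 h4
      rwa [circle_out] at this
    · intro h e h1 h2
      obtain ⟨h3, h4⟩ := (hnear _).1 ⟨h1, h2⟩
      rw [h _ h3 h4]
      exact ht e fun hn => hn.elim h1 h2
  have haway : Compatible v κ → ∏ k ∈ awayCircles v c, evalCoeff F (κ (Quot.out k)) (l k) =
      ∏ k ∈ awayCircles (flipAt v c) c, evalCoeff F (κ (Quot.out k)) (t k) := by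
    intro hv
    apply prod_awayCircles_flip
    intro e he
    rw [hv.out, hκ.out, ht e he]
  have hmem : ∀ {k : D.Circle (flipAt v c)}, k ∈ awayCircles (flipAt v c) c →
      k ≠ D.circle (flipAt v c) (D.inEdge (some (c, true))) ∧
      k ≠ D.circle (flipAt v c) (D.outEdge (some (c, true))) := by
    intro k hk
    simpa [awayCircles] using hk
  by_cases hc : D.circle v (D.inEdge (some (c, true))) = D.circle v (D.outEdge (some (c, true)))
  · have hc' : D.circle (flipAt v c) (D.inEdge (some (c, true))) ≠
        D.circle (flipAt v c) (D.outEdge (some (c, true))) :=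
      fun h => (circle_flip_eq_iff v c).1 h hc
    have hedge : ∀ l', stateWeight F (flipAt v c) κ l' * edgeCoeff F D c ⟨v, l⟩ ⟨flipAt v c, l'⟩ =
        if ∀ k, k ≠ D.circle (flipAt v c) (D.inEdge (some (c, true))) →
          k ≠ D.circle (flipAt v c) (D.outEdge (some (c, true))) → l' k = t k then
        stateWeight F (flipAt v c) κ l' * comulCoeff F (l (D.circle v (D.inEdge (some (c, true)))))
          (l' (D.circle (flipAt v c) (D.inEdge (some (c, true)))))
          (l' (D.circle (flipAt v c) (D.outEdge (some (c, true))))) else 0 := by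
      intro l'
      by_cases hT : ∀ e, D.circle v e ≠ D.circle v (D.inEdge (some (c, true))) →
        D.circle v e ≠ D.circle v (D.outEdge (some (c, true))) →
        l' (D.circle (flipAt v c) e) = l (D.circle v e)
      · rw [if_pos ((hcond l').1 hT), edgeCoeff, if_pos hT, if_neg (fun h => h.1 hc),
          if_pos ⟨hc, hc'⟩]
      · rw [if_neg (fun h => hT ((hcond l').2 h)), edgeCoeff, if_neg hT, mul_zero]
    rw [Finset.sum_congr rfl fun l' _ => hedge l', sum_eq_sum_update_two hc']
    have hterm : ∀ y z, stateWeight F (flipAt v c) κ (Function.update (Function.update t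
        (D.circle (flipAt v c) (D.inEdge (some (c, true)))) y)
        (D.circle (flipAt v c) (D.outEdge (some (c, true)))) z) =
        evalCoeff F (κ (D.inEdge (some (c, true)))) y *
        evalCoeff F (κ (D.outEdge (some (c, true)))) z *
        ∏ k ∈ awayCircles (flipAt v c) c, evalCoeff F (κ (Quot.out k)) (t k) := by
      intro y z
      rw [stateWeight, prod_circles_eq (flipAt v c) c, if_neg hc', hκ.out, hκ.out,
        Function.update_of_ne hc', Function.update_self, Function.update_self]
      congr 1
      refine Finset.prod_congr rfl fun k hk => ?_
      rw [Function.update_of_ne (hmem hk).2, Function.update_of_ne (hmem hk).1]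
    simp only [hterm, Function.update_of_ne hc', Function.update_self]
    rw [hflip, bifurcationFactor, if_pos hc]
    have := sum_evalCoeff_comulCoeff (F := F) (κ (D.inEdge (some (c, true))))
      (κ (D.outEdge (some (c, true)))) (l (D.circle v (D.inEdge (some (c, true)))))
    calc _ = (∑ y, ∑ z, evalCoeff F (κ (D.inEdge (some (c, true)))) y *
          evalCoeff F (κ (D.outEdge (some (c, true)))) z *
          comulCoeff F (l (D.circle v (D.inEdge (some (c, true))))) y z) *
          ∏ k ∈ awayCircles (flipAt v c) c, evalCoeff F (κ (Quot.out k)) (t k) := by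
          simp only [Finset.sum_mul]
          refine Finset.sum_congr rfl fun y _ => Finset.sum_congr rfl fun z _ => by ring
      _ = _ := by
          rw [this]
          split_ifs with hcol
          · have hv := hflip.2 hcol
            rw [stateWeight, prod_circles_eq v c, if_pos hc, hv.out, haway hv, mul_assoc]
          · rw [zero_mul]
  · have hc' : D.circle (flipAt v c) (D.inEdge (some (c, true))) =
        D.circle (flipAt v c) (D.outEdge (some (c, true))) := (circle_flip_eq_iff v c).2 hc
    have hcol := hκ.eq_of_circle_eq hc'
    have hv := hflip.2 hcol
    have hedge : ∀ l', stateWeight F (flipAt v c) κ l' * edgeCoeff F D c ⟨v, l⟩ ⟨flipAt v c, l'⟩ =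
        if ∀ k, k ≠ D.circle (flipAt v c) (D.inEdge (some (c, true))) → l' k = t k then
        stateWeight F (flipAt v c) κ l' * mulCoeff F (l (D.circle v (D.inEdge (some (c, true)))))
          (l (D.circle v (D.outEdge (some (c, true)))))
          (l' (D.circle (flipAt v c) (D.inEdge (some (c, true))))) else 0 := by
      intro l'
      by_cases hT : ∀ e, D.circle v e ≠ D.circle v (D.inEdge (some (c, true))) →
        D.circle v e ≠ D.circle v (D.outEdge (some (c, true))) →
        l' (D.circle (flipAt v c) e) = l (D.circle v e)
      · rw [if_pos fun k hk => (hcond l').1 hT k hk (hc' ▸ hk), edgeCoeff, if_pos hT,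
          if_pos ⟨hc, hc'⟩]
      · rw [if_neg (fun h => hT ((hcond l').2 fun k hk _ => h k hk)), edgeCoeff, if_neg hT, mul_zero]
    rw [Finset.sum_congr rfl fun l' _ => hedge l', sum_eq_sum_update_one]
    have hterm : ∀ y, stateWeight F (flipAt v c) κ (Function.update t
        (D.circle (flipAt v c) (D.inEdge (some (c, true)))) y) =
        evalCoeff F (κ (D.inEdge (some (c, true)))) y *
        ∏ k ∈ awayCircles (flipAt v c) c, evalCoeff F (κ (Quot.out k)) (t k) := by
      intro y
      rw [stateWeight, prod_circles_eq (flipAt v c) c, if_pos hc', hκ.out, Function.update_self]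
      congr 1
      refine Finset.prod_congr rfl fun k hk => ?_
      rw [Function.update_of_ne (hmem hk).1]
    simp only [hterm, Function.update_self]
    rw [if_pos hv, bifurcationFactor, if_neg hc, one_mul, stateWeight, prod_circles_eq v c,
      if_neg hc, hv.out, hv.out, haway hv, ← hcol, ← sum_evalCoeff_mulCoeff, Finset.sum_mul]
    exact Finset.sum_congr rfl fun y _ => by ring

/-! ### The differential on coloured resolutions -/

variable (F) in
/-- The sign of the edges of the cube in direction `c` at the vertex `v`. -/
def cubeSign (v : D.Vertex) (c : Fin D.n) : F[X] :=
  (-1) ^ (Finset.univ.filter fun j => j < c ∧ v j = true).card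

variable (F) in
/-- The coefficient with which the evaluation at `(flipAt v c, κ)` occurs in the evaluation at `(v, κ)`
of the image of a chain under the edge map at `c`. -/
def edgeWeight (v : D.Vertex) (c : Fin D.n) (κ : D.Edge → Bool) : F[X] :=
  open Classical in
  if Compatible (flipAt v c) κ then cubeSign F (flipAt v c) c * bifurcationFactor F (flipAt v c) c κ else 0

variable (F) in
/-- The signed edge maps that change the smoothing of `c` to `b`.  For `b = true` this is the part of
the differential in direction `c`; for `b = false` it is the homotopy that goes backwards. -/
def changeMap (c : Fin D.n) (b : Bool) : Chain F D →ₗ[F[X]] Chain F D :=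
  Matrix.mulVecLin (Matrix.of fun t s : D.State =>
    if t.1 c = b ∧ t.1 = flipAt s.1 c then cubeSign F s.1 c * edgeCoeff F D c s t else 0)

theorem changeMap_apply (c : Fin D.n) (b : Bool) (x : Chain F D) (t : D.State) :
    changeMap F c b x t = ∑ s : D.State,
      (if t.1 c = b ∧ t.1 = flipAt s.1 c then cubeSign F s.1 c * edgeCoeff F D c s t else 0) * x s :=
  rfl

theorem differential_apply (x : Chain F D) (t : D.State) :
    differential F D x t = ∑ s : D.State, differentialMatrix F D t s * x s :=
  rfl

theorem differential_eq_sum : differential F D = ∑ c, changeMap F c true := by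
  refine LinearMap.ext fun x => funext fun t => ?_
  rw [LinearMap.sum_apply, Finset.sum_apply]
  simp only [differential_apply, changeMap_apply, differentialMatrix]
  rw [Finset.sum_comm]
  refine Finset.sum_congr rfl fun s _ => ?_
  rw [Finset.sum_mul]
  refine Finset.sum_congr rfl fun c _ => ?_
  congr 1
  refine if_congr ?_ rfl rfl
  constructor
  · rintro ⟨h1, h2⟩
    refine ⟨by rw [h2]; simp, ?_⟩
    rw [h2, flipAt, h1]; rfl
  · rintro ⟨h1, h2⟩
    have h3 : s.1 c = false := by
      rw [h2, flipAt_same] at h1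
      simpa using h1
    refine ⟨h3, ?_⟩
    rw [h2, flipAt, h3]; rfl

theorem colorEval_changeMap {v : D.Vertex} {κ : D.Edge → Bool} (hκ : Compatible v κ) (c : Fin D.n)
    (b : Bool) (x : Chain F D) : colorEval v κ (changeMap F c b x) =
      if v c = b then edgeWeight F v c κ * colorEval (flipAt v c) κ x else 0 := by
  classical
  rw [colorEval_apply]
  simp only [changeMap_apply]
  split_ifs with hb
  · obtain ⟨w, rfl⟩ : ∃ w, v = flipAt w c := ⟨flipAt v c, (flipAt_flipAt v c).symm⟩
    rw [edgeWeight, flipAt_flipAt]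
    have hs : ∀ l', ∑ s : D.State, (if flipAt w c c = b ∧ flipAt w c = flipAt s.1 c then
        cubeSign F s.1 c * edgeCoeff F D c s ⟨flipAt w c, l'⟩ else 0) * x s =
        ∑ l, cubeSign F w c * edgeCoeff F D c ⟨w, l⟩ ⟨flipAt w c, l'⟩ * x ⟨w, l⟩ := by
      intro l'
      rw [Fintype.sum_sigma, Finset.sum_eq_single w]
      · refine Finset.sum_congr rfl fun l _ => ?_
        rw [if_pos ⟨hb, rfl⟩]
      · intro u _ hu
        refine Finset.sum_eq_zero fun l _ => ?_
        rw [if_neg, zero_mul]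
        rintro ⟨_, h⟩
        exact hu (by have := congrArg (fun z => flipAt z c) h; simpa using this.symm)
      · simp
    rw [Finset.sum_congr rfl fun l' _ => by rw [hs l']]
    simp_rw [Finset.mul_sum]
    rw [Finset.sum_comm, colorEval_apply, Finset.mul_sum]
    refine Finset.sum_congr rfl fun l _ => ?_
    have := sum_stateWeight_edgeCoeff (F := F) w c hκ l
    calc _ = (∑ l', stateWeight F (flipAt w c) κ l' * edgeCoeff F D c ⟨w, l⟩ ⟨flipAt w c, l'⟩) *
          (cubeSign F w c * x ⟨w, l⟩) := by
          rw [Finset.sum_mul]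
          exact Finset.sum_congr rfl fun l' _ => by ring
      _ = _ := by
          rw [this]
          split_ifs <;> ring
  · refine Finset.sum_eq_zero fun l _ => ?_
    rw [Finset.sum_eq_zero, mul_zero]
    intro s _
    rw [if_neg (fun h => hb h.1), zero_mul]

theorem colorEval_differential {v : D.Vertex} {κ : D.Edge → Bool} (hκ : Compatible v κ)
    (x : Chain F D) : colorEval v κ (differential F D x) =
      ∑ c, if v c = true then edgeWeight F v c κ * colorEval (flipAt v c) κ x else 0 := by
  rw [differential_eq_sum, LinearMap.sum_apply, map_sum]
  exact Finset.sum_congr rfl fun c _ => colorEval_changeMap hκ c true x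

/-! ### Anticommutation and the homotopy between the two edges of a strand -/

/-- The number of circles of the resolution `v` that have the colour `b`. -/
def colorCount (v : D.Vertex) (κ : D.Edge → Bool) (b : Bool) : ℤ :=
  ∑ k : D.Circle v, if κ (Quot.out k) = b then 1 else 0

/-- `1` if the edge map at `c` that leaves `v` splits a circle of the colour `b`, otherwise `0`. -/
def splitCount (v : D.Vertex) (c : Fin D.n) (κ : D.Edge → Bool) (b : Bool) : ℕ :=
  open Classical in
  if D.circle v (D.inEdge (some (c, true))) = D.circle v (D.outEdge (some (c, true))) ∧
    κ (D.inEdge (some (c, true))) = b then 1 else 0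

theorem bifurcationFactor_eq (v : D.Vertex) (c : Fin D.n) (κ : D.Edge → Bool) :
    bifurcationFactor F v c κ = h F ^ splitCount v c κ true * (- h F) ^ splitCount v c κ false := by
  rw [bifurcationFactor, splitCount, splitCount]
  by_cases h : D.circle v (D.inEdge (some (c, true))) = D.circle v (D.outEdge (some (c, true)))
  · cases hb : κ (D.inEdge (some (c, true))) <;> simp [h, handleValue]
  · simp [h]

/-- Splits are detected by the change of the number of circles. -/
theorem two_mul_splitCount {v : D.Vertex} {c : Fin D.n} {κ : D.Edge → Bool} (hv : Compatible v κ)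
    (hv' : Compatible (flipAt v c) κ) (b : Bool) :
    2 * (splitCount v c κ b : ℤ) = colorCount (flipAt v c) κ b - colorCount v κ b +
      if κ (D.inEdge (some (c, true))) = b then 1 else 0 := by
  have hcol := (hv.flip_iff c).1 hv'
  rw [colorCount, colorCount, sum_circles_eq v c, sum_circles_eq (flipAt v c) c,
    sum_awayCircles_flip v c _ fun k => if κ (Quot.out k) = b then (1 : ℤ) else 0]
  · rw [hv.out, hv.out, hv'.out, hv'.out, ← hcol, splitCount]
    have := circle_flip_eq_iff v c
    by_cases h : D.circle v (D.inEdge (some (c, true))) = D.circle v (D.outEdge (some (c, true)))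
    · rw [if_pos h, if_neg (fun h' => this.1 h' h)]
      split_ifs <;> simp_all
    · rw [if_neg h, if_pos (this.2 h), if_neg (fun h' => h h'.1)]
      simp
  · intro e _
    rw [hv.out, hv'.out]

/-- The two paths around a square of the cube have the same number of splits of each colour, because
the colours of the two crossings and the change of the number of circles are the same. -/
theorem bifurcationFactor_square {w : D.Vertex} {κ : D.Edge → Bool} {c c' : Fin D.n}
    (h0 : Compatible w κ) (h1 : Compatible (flipAt w c) κ) (h2 : Compatible (flipAt w c') κ)
    (h3 : Compatible (flipAt (flipAt w c) c') κ) :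
    bifurcationFactor F w c κ * bifurcationFactor F (flipAt w c) c' κ =
      bifurcationFactor F w c' κ * bifurcationFactor F (flipAt w c') c κ := by
  have key : ∀ b, splitCount w c κ b + splitCount (flipAt w c) c' κ b =
      splitCount w c' κ b + splitCount (flipAt w c') c κ b := by
    intro b
    have e1 := two_mul_splitCount h0 h1 b
    have e2 := two_mul_splitCount h1 h3 b
    have e3 := two_mul_splitCount h0 h2 b
    have e4 := two_mul_splitCount h2 (by rwa [flipAt_comm] at h3) b
    rw [flipAt_comm] at e4
    omega
  simp only [bifurcationFactor_eq]
  rw [mul_mul_mul_comm, ← pow_add, ← pow_add, key, key, pow_add, pow_add, mul_mul_mul_comm]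

theorem cubeSign_flipAt (v : D.Vertex) (c c' : Fin D.n) :
    cubeSign F (flipAt v c) c' = if c < c' then - cubeSign F v c' else cubeSign F v c' := by
  have key : ∀ v : D.Vertex, cubeSign F v c' = ∏ j, if j < c' ∧ v j = true then (-1 : F[X]) else 1 := by
    intro v
    rw [cubeSign, Finset.prod_ite, Finset.prod_const, Finset.prod_const_one, mul_one]
  rw [key, key, ← Finset.mul_prod_erase _ _ (Finset.mem_univ c),
    ← Finset.mul_prod_erase _ (fun j => if j < c' ∧ v j = true then (-1 : F[X]) else 1)
      (Finset.mem_univ c)]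
  have hrest : ∏ j ∈ Finset.univ.erase c, (if j < c' ∧ flipAt v c j = true then (-1 : F[X]) else 1) =
      ∏ j ∈ Finset.univ.erase c, (if j < c' ∧ v j = true then (-1 : F[X]) else 1) :=
    Finset.prod_congr rfl fun j hj => by rw [flipAt_ne v (Finset.ne_of_mem_erase hj)]
  rw [hrest, flipAt_same]
  by_cases hlt : c < c' <;> cases v c <;> simp [hlt]

theorem cubeSign_mul_self (v : D.Vertex) (c : Fin D.n) : cubeSign F v c * cubeSign F v c = 1 := by
  rw [cubeSign, ← mul_pow]; simp

theorem edgeWeight_of_eq {v : D.Vertex} {κ : D.Edge → Bool} (hv : Compatible v κ) {c : Fin D.n}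
    (hc : κ (D.inEdge (some (c, true))) = κ (D.outEdge (some (c, true)))) :
    edgeWeight F v c κ = cubeSign F v c * bifurcationFactor F (flipAt v c) c κ := by
  rw [edgeWeight, if_pos ((hv.flip_iff c).2 hc), cubeSign_flipAt, if_neg (lt_irrefl c)]

theorem edgeWeight_of_ne {v : D.Vertex} {κ : D.Edge → Bool} (hv : Compatible v κ) {c : Fin D.n}
    (hc : κ (D.inEdge (some (c, true))) ≠ κ (D.outEdge (some (c, true)))) :
    edgeWeight F v c κ = 0 := by
  rw [edgeWeight, if_neg (fun h => hc ((hv.flip_iff c).1 h))]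

theorem edgeWeight_anticomm {v : D.Vertex} {κ : D.Edge → Bool} (hv : Compatible v κ)
    {c c' : Fin D.n} (hcc : c ≠ c') :
    edgeWeight F v c κ * edgeWeight F (flipAt v c) c' κ +
      edgeWeight F v c' κ * edgeWeight F (flipAt v c') c κ = 0 := by
  by_cases hc : κ (D.inEdge (some (c, true))) = κ (D.outEdge (some (c, true)))
  · by_cases hc' : κ (D.inEdge (some (c', true))) = κ (D.outEdge (some (c', true)))
    · have h1 := (hv.flip_iff c).2 hc
      have h2 := (hv.flip_iff c').2 hc'
      have h3 := (h1.flip_iff c').2 hc'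
      rw [edgeWeight_of_eq hv hc, edgeWeight_of_eq hv hc', edgeWeight_of_eq h1 hc',
        edgeWeight_of_eq h2 hc, cubeSign_flipAt, cubeSign_flipAt]
      have hsq := bifurcationFactor_square (F := F) (w := flipAt (flipAt v c) c') (c := c) (c' := c')
        h3 (by rwa [flipAt_comm v, flipAt_flipAt]) (by rwa [flipAt_flipAt])
        (by rwa [flipAt_comm v, flipAt_flipAt, flipAt_flipAt])
      rw [flipAt_flipAt, flipAt_comm v, flipAt_flipAt] at hsq
      rw [flipAt_comm v]
      rcases lt_or_gt_of_ne hcc with hlt | hlt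
      · rw [if_pos hlt, if_neg hlt.not_gt]
        linear_combination cubeSign F v c * cubeSign F v c' * hsq
      · rw [if_pos hlt, if_neg hlt.not_gt]
        linear_combination -cubeSign F v c * cubeSign F v c' * hsq
    · rw [edgeWeight_of_ne hv hc', edgeWeight_of_ne ((hv.flip_iff c).2 hc) hc', mul_zero, zero_mul,
        add_zero]
  · rw [edgeWeight_of_ne hv hc, zero_mul, zero_add]
    by_cases hc' : κ (D.inEdge (some (c', true))) = κ (D.outEdge (some (c', true)))
    · rw [edgeWeight_of_ne ((hv.flip_iff c').2 hc') hc, mul_zero]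
    · rw [edgeWeight_of_ne hv hc', zero_mul]

theorem edgeWeight_mul_edgeWeight {v : D.Vertex} {κ : D.Edge → Bool} (hv : Compatible v κ)
    (c : Fin D.n) : edgeWeight F v c κ * edgeWeight F (flipAt v c) c κ =
      (if κ (D.inEdge (some (c, true))) then h F else 0) +
        (if κ (D.outEdge (some (c, true))) then h F else 0) - h F := by
  by_cases hc : κ (D.inEdge (some (c, true))) = κ (D.outEdge (some (c, true)))
  · rw [edgeWeight_of_eq hv hc, edgeWeight_of_eq ((hv.flip_iff c).2 hc) hc, cubeSign_flipAt,
      if_neg (lt_irrefl c), mul_mul_mul_comm, cubeSign_mul_self, one_mul, flipAt_flipAt, ← hc]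
    have hbf : bifurcationFactor F (flipAt v c) c κ * bifurcationFactor F v c κ =
        handleValue F (κ (D.inEdge (some (c, true)))) := by
      have := circle_flip_eq_iff v c
      rw [bifurcationFactor, bifurcationFactor]
      by_cases h : D.circle v (D.inEdge (some (c, true))) = D.circle v (D.outEdge (some (c, true)))
      · rw [if_pos h, if_neg (fun h' => this.1 h' h), one_mul]
      · rw [if_neg h, if_pos (this.2 h), mul_one]
    rw [hbf, handleValue]
    split_ifs <;> ring
  · rw [edgeWeight_of_ne hv hc, zero_mul]
    cases h1 : κ (D.inEdge (some (c, true))) <;> cases h2 : κ (D.outEdge (some (c, true))) <;>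
      simp_all

/-- An evaluation at a neighbouring resolution that is not compatible occurs with weight zero. -/
theorem edgeWeight_mul_congr {v : D.Vertex} {κ : D.Edge → Bool} (c : Fin D.n) {p q : F[X]}
    (hpq : Compatible (flipAt v c) κ → p = q) : edgeWeight F v c κ * p = edgeWeight F v c κ * q := by
  by_cases h : Compatible (flipAt v c) κ
  · rw [hpq h]
  · rw [edgeWeight, if_neg h, zero_mul, zero_mul]

/-- The contributions of different crossings cancel by anticommutation.  At `c` itself the composite of
a merge and a split is the value of the handle element if `κ` does not change along the strand; if it
does, the composite vanishes, as does the right hand side. -/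
theorem colorEval_homotopy {v : D.Vertex} {κ : D.Edge → Bool} (hv : Compatible v κ)
    (c : Fin D.n) (x : Chain F D) :
    colorEval v κ (changeMap F c false (differential F D x) +
      differential F D (changeMap F c false x)) =
    ((if κ (D.inEdge (some (c, true))) then h F else 0) +
        (if κ (D.outEdge (some (c, true))) then h F else 0) - h F) * colorEval v κ x := by
  have e1 : colorEval v κ (changeMap F c false (differential F D x)) = ∑ c',
      if v c = false ∧ flipAt v c c' = true then edgeWeight F v c κ *
        (edgeWeight F (flipAt v c) c' κ * colorEval (flipAt (flipAt v c) c') κ x) else 0 := by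
    rw [colorEval_changeMap hv]
    split_ifs with hc
    · rw [edgeWeight_mul_congr c fun h => colorEval_differential h x, Finset.mul_sum]
      refine Finset.sum_congr rfl fun c' _ => ?_
      rw [mul_ite, mul_zero]
      simp only [hc, true_and]
    · simp [hc]
  have e2 : colorEval v κ (differential F D (changeMap F c false x)) = ∑ c',
      if v c' = true ∧ flipAt v c' c = false then edgeWeight F v c' κ *
        (edgeWeight F (flipAt v c') c κ * colorEval (flipAt (flipAt v c') c) κ x) else 0 := by
    rw [colorEval_differential hv]
    refine Finset.sum_congr rfl fun c' _ => ?_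
    rw [edgeWeight_mul_congr c' fun h => colorEval_changeMap h c false x, mul_ite, mul_zero]
    split_ifs <;> simp_all
  rw [map_add, e1, e2, ← Finset.sum_add_distrib, Finset.sum_eq_single c]
  · rw [flipAt_flipAt, ← edgeWeight_mul_edgeWeight hv, flipAt_same]
    cases v c <;> simp <;> ring
  · intro c' _ hc'
    rw [flipAt_ne v hc', flipAt_ne v hc'.symm, flipAt_comm v c' c]
    have := edgeWeight_anticomm (F := F) hv hc'
    by_cases h1 : v c = false <;> by_cases h2 : v c' = true
    · rw [if_pos ⟨h1, h2⟩, if_pos ⟨h2, h1⟩]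
      linear_combination colorEval (flipAt (flipAt v c) c') κ x * this
    all_goals simp [h1, h2]
  · simp

/-- On homology, the actions of `X` on the two edges of a strand add up to `h`. -/
theorem homotopy (c : Fin D.n) (o : Bool) (x : Chain F D) :
    changeMap F c false (differential F D x) + differential F D (changeMap F c false x) =
      mulX (D.inEdge (some (c, o))) x + mulX (D.outEdge (some (c, o))) x - h F • x := by
  refine chain_ext fun v κ hv => ?_
  rw [colorEval_homotopy hv, map_sub, map_add, colorEval_mulX hv, colorEval_mulX hv, map_smul,
    smul_eq_mul, ← add_mul, ← sub_mul]
  congr 2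
  cases o
  · rcases hv.strand c with ⟨h1, h2⟩ | ⟨h1, h2⟩
    · rw [h1, h2]
    · rw [h1, h2, add_comm]
  · rfl

theorem mulX_differential (e : D.Edge) (x : Chain F D) :
    mulX e (differential F D x) = differential F D (mulX e x) := by
  refine chain_ext fun v κ hv => ?_
  rw [colorEval_mulX hv, colorEval_differential hv, colorEval_differential hv, Finset.mul_sum]
  refine Finset.sum_congr rfl fun c _ => ?_
  by_cases hc : v c = true
  · rw [if_pos hc, if_pos hc, edgeWeight_mul_congr c fun h => colorEval_mulX h e x]
    ring
  · rw [if_neg hc, if_neg hc, mul_zero]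

theorem colorProj_differential (e : D.Edge) (b : Bool) (x : Chain F D) :
    colorProj e b (differential F D x) = differential F D (colorProj e b x) := by
  cases b <;> simp [colorProj, mulX_differential]

theorem handleValue_comp (b : Bool) : (handleValue F b).comp (- h F) = handleValue F (!b) := by
  cases b <;> simp [handleValue]

theorem edgeWeight_comp (v : D.Vertex) (c : Fin D.n) (κ : D.Edge → Bool) :
    (edgeWeight F v c fun e => !κ e).comp (- h F) = edgeWeight F v c κ := by
  have hcompat : Compatible (flipAt v c) (fun e => !κ e) ↔ Compatible (flipAt v c) κ :=
    ⟨fun h => by simpa using h.not, fun h => h.not⟩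
  rw [edgeWeight, edgeWeight]
  by_cases h : Compatible (flipAt v c) κ
  · rw [if_pos h, if_pos (hcompat.2 h), bifurcationFactor, bifurcationFactor, Polynomial.mul_comp]
    congr 1
    · simp [cubeSign]
    · split_ifs
      · rw [handleValue_comp, Bool.not_not]
      · simp
  · rw [if_neg h, if_neg (fun h' => h (hcompat.1 h'))]; simp

theorem hatSigma_differential (x : Chain F D) :
    hatSigma (differential F D x) = differential F D (hatSigma x) := by
  refine chain_ext fun v κ hv => ?_
  rw [colorEval_hatSigma, colorEval_differential hv, colorEval_differential hv.not,
    Polynomial.sum_comp]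
  refine Finset.sum_congr rfl fun c _ => ?_
  rw [colorEval_hatSigma]
  split_ifs
  · rw [Polynomial.mul_comp, edgeWeight_comp]
  · simp

/-! ### The two canonical colourings and the torsion of the homology -/

variable (D) in
/-- The resolution all of whose smoothings respect the orientation of the knot. -/
def orientedVertex : D.Vertex := fun c => !(D.positive c)

variable (D) in
theorem exists_isAlternating_base : ∃ κ, D.IsAlternating κ ∧ κ (D.outEdge none) = true := by
  obtain ⟨κ, hκ⟩ := D.exists_isAlternating
  cases h : κ (D.outEdge none)
  · exact ⟨_, hκ.not, by rw [h]; rfl⟩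
  · exact ⟨κ, hκ, h⟩

variable (D) in
/-- The alternating colouring in which the base point has the colour `b`. -/
def altColor (b : Bool) (e : D.Edge) : Bool := Classical.choose (exists_isAlternating_base D) e == b

theorem altColor_isAlternating (b : Bool) : D.IsAlternating (altColor D b) := by
  have h := (Classical.choose_spec (exists_isAlternating_base D)).1
  cases b
  · have : altColor D false = fun e => !Classical.choose (exists_isAlternating_base D) e := by
      funext e; simp [altColor]
    rw [this]
    exact h.not
  · have : altColor D true = Classical.choose (exists_isAlternating_base D) := by
      funext e; simp [altColor]
    rwa [this]

theorem altColor_base (b : Bool) : altColor D b (D.outEdge none) = b := by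
  rw [altColor, (Classical.choose_spec (exists_isAlternating_base D)).2]
  cases b <;> rfl

theorem not_altColor (b : Bool) : (fun e => !altColor D b e) = altColor D (!b) := by
  funext e
  rw [altColor, altColor]
  cases Classical.choose (exists_isAlternating_base D) e <;> cases b <;> rfl

/-- An alternating colouring is compatible with the oriented resolution only. -/
theorem compatible_iff_of_isAlternating {κ : D.Edge → Bool} (hκ : D.IsAlternating κ)
    (v : D.Vertex) : Compatible v κ ↔ v = orientedVertex D := by
  constructor
  · intro h
    funext c
    by_contra hc
    have hc' : v c = D.positive c := by
      rw [orientedVertex] at hc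
      simpa using hc
    have := h _ _ (Joined.disoriented_in c hc')
    rw [hκ.oriented, hκ.changes] at this
    simp at this
  · rintro rfl e f hef
    induction hef with
    | base => exact hκ.base
    | oriented c o _ => exact hκ.oriented c o
    | disoriented_in c hc => simp [orientedVertex] at hc
    | disoriented_out c hc => simp [orientedVertex] at hc

theorem compatible_altColor (b : Bool) : Compatible (orientedVertex D) (altColor D b) :=
  (compatible_iff_of_isAlternating (altColor_isAlternating b) _).2 rfl

/-- The functional on chains given by the canonical colouring with base colour `b`, on the oriented
resolution.  It is dual to Lee's canonical generator. -/
def canonicalEval (b : Bool) : Chain F D →ₗ[F[X]] F[X] :=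
  colorEval (orientedVertex D) (altColor D b)

theorem canonicalEval_differential (b : Bool) (x : Chain F D) :
    canonicalEval b (differential F D x) = 0 := by
  rw [canonicalEval, colorEval_differential (compatible_altColor b)]
  refine Finset.sum_eq_zero fun c _ => ?_
  rw [edgeWeight_of_ne (compatible_altColor b), zero_mul, ite_self]
  rw [(altColor_isAlternating b).changes]
  simp

theorem canonicalEval_eq_zero_of_mem {b : Bool} {x : Chain F D} (hx : x ∈ baseColor F D b) :
    canonicalEval (!b) x = 0 :=
  hx _ _ (compatible_altColor _) (altColor_base _)

theorem canonicalEval_colorProj (b b' : Bool) (x : Chain F D) :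
    canonicalEval b' (colorProj (D.outEdge none) b x) =
      if b' = b then h F * canonicalEval b' x else 0 := by
  rw [canonicalEval, colorEval_colorProj (compatible_altColor b'), altColor_base]

theorem h_mul_canonicalEval_hatNu (b : Bool) (x : Chain F D) :
    h F * canonicalEval b (hatNu x) =
      canonicalEval b x - (canonicalEval (!b) x).comp (- h F) := by
  rw [canonicalEval, h_mul_colorEval_hatNu, not_altColor]
  rfl

theorem canonicalEval_hatSigma (b : Bool) (x : Chain F D) :
    canonicalEval b (hatSigma x) = (canonicalEval (!b) x).comp (- h F) := by
  rw [canonicalEval, colorEval_hatSigma, not_altColor]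
  rfl

theorem mem_cycles {C : Submodule F[X] (Chain F D)} {x : Chain F D} :
    x ∈ cycles C ↔ x ∈ C ∧ differential F D x = 0 := Iff.rfl

theorem colorProj_mem_baseColor (b : Bool) (x : Chain F D) :
    colorProj (D.outEdge none) b x ∈ baseColor F D b := by
  intro v κ hκ hb
  rw [colorEval_colorProj hκ, if_neg]
  rw [hb]; simp

theorem changeMap_mem_baseColor {b : Bool} {x : Chain F D} (hx : x ∈ baseColor F D b) (c : Fin D.n)
    (b' : Bool) : changeMap F c b' x ∈ baseColor F D b := by
  intro v κ hκ hb
  rw [colorEval_changeMap hκ, edgeWeight_mul_congr c fun hκ' => hx _ _ hκ' hb, mul_zero, ite_self]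

theorem hatSigma_mem_baseColor {b : Bool} {x : Chain F D} (hx : x ∈ baseColor F D b) :
    hatSigma x ∈ baseColor F D (!b) := by
  intro v κ hκ hb
  rw [colorEval_hatSigma, hx v _ hκ.not (by simp [hb]), Polynomial.zero_comp]

theorem hatNu_differential_eq_zero {x : Chain F D} (hx : differential F D x = 0) :
    differential F D (hatNu x) = 0 := by
  have h1 : h F • differential F D (hatNu x) = 0 := by
    rw [← map_smul, h_smul_hatNu, map_sub, ← hatSigma_differential, hx, zero_sub, neg_eq_zero]
    exact chain_ext fun v κ _ => by rw [colorEval_hatSigma]; simp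
  exact (smul_eq_zero.1 h1).resolve_left Polynomial.X_ne_zero

/-- On the homology of a reduced complex, each edge acts on the label as prescribed by the canonical
colouring: this holds at the base point, and passes from one edge to the next by `homotopy`. -/
theorem exists_h_smul_sub_colorProj (b : Bool) {z : Chain F D} (hz : z ∈ cycles (baseColor F D b))
    (e : D.Edge) : ∃ u ∈ baseColor F D b,
      h F • z - colorProj e (altColor D b e) z = differential F D u := by
  obtain ⟨hzb, hdz⟩ := mem_cycles.1 hz
  have hbase : h F • z - colorProj (D.outEdge none) (altColor D b (D.outEdge none)) z = 0 := by
    refine chain_ext fun v κ hκ => ?_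
    rw [map_sub, map_smul, colorEval_colorProj hκ, altColor_base, smul_eq_mul, map_zero]
    split_ifs with h
    · rw [sub_self]
    · rw [hzb v κ hκ (Bool.eq_not.2 h), mul_zero, sub_zero]
  refine D.next_induction (p := fun e => ∃ u ∈ baseColor F D b,
      h F • z - colorProj e (altColor D b e) z = differential F D u) (e := D.outEdge none) ?_ ?_ e
  · exact ⟨0, zero_mem _, by rw [hbase, map_zero]⟩
  · rintro e ⟨u, hu, hue⟩
    obtain ⟨p, rfl⟩ : ∃ p, e = D.inEdge p := ⟨D.next e, by simp⟩
    rw [show D.next (D.inEdge p) = D.outEdge p by simp]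
    rcases p with _ | ⟨c, o⟩
    · exact ⟨0, zero_mem _, by rw [hbase, map_zero]⟩
    · have hK := homotopy c o z
      rw [hdz, map_zero, zero_add] at hK
      have hKz := changeMap_mem_baseColor hzb c false
      rw [(altColor_isAlternating b).changes] at hue
      cases hb : altColor D b (D.outEdge (some (c, o)))
      · rw [hb] at hue
        refine ⟨u + changeMap F c false z, add_mem hu hKz, ?_⟩
        rw [map_add, hK, ← hue]
        simp only [colorProj, Bool.not_false, if_true, Bool.false_eq_true, if_false,
          LinearMap.sub_apply, LinearMap.smul_apply, LinearMap.id_apply]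
        abel
      · rw [hb] at hue
        refine ⟨u - changeMap F c false z, sub_mem hu hKz, ?_⟩
        rw [map_sub, hK, ← hue]
        simp only [colorProj, Bool.not_true, if_true, Bool.false_eq_true, if_false,
          LinearMap.sub_apply, LinearMap.smul_apply, LinearMap.id_apply]
        abel

/-- The composition of the operators `colorProj` over a set `S` of edges isolates the colourings that
agree with the canonical one on `S`.  It is a chain map, and on the homology of the reduced complex
it is a power of `h`. -/
theorem exists_canonicalProj (b : Bool) (S : Finset D.Edge) :
    ∃ P : Chain F D →ₗ[F[X]] Chain F D,
      (∀ x, P (differential F D x) = differential F D (P x)) ∧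
      (∀ v κ, Compatible v κ → ∀ x, colorEval v κ (P x) =
        if ∀ e ∈ S, κ e = altColor D b e then h F ^ S.card * colorEval v κ x else 0) ∧
      ∀ z ∈ cycles (baseColor F D b), ∃ u ∈ baseColor F D b,
        h F ^ S.card • z - P z = differential F D u := by
  classical
  induction S using Finset.induction_on with
  | empty =>
    refine ⟨LinearMap.id, fun x => rfl, fun v κ _ x => by simp, fun z _ => ⟨0, zero_mem _, ?_⟩⟩
    simp
  | insert e S he ih =>
    obtain ⟨P, h1, h2, h3⟩ := ih
    refine ⟨colorProj e (altColor D b e) ∘ₗ P, fun x => ?_, fun v κ hκ x => ?_, fun z hz => ?_⟩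
    · rw [LinearMap.comp_apply, h1, colorProj_differential, LinearMap.comp_apply]
    · rw [LinearMap.comp_apply, colorEval_colorProj hκ, h2 v κ hκ, Finset.card_insert_of_notMem he]
      simp only [Finset.forall_mem_insert]
      by_cases h : κ e = altColor D b e
      · simp only [h, if_true, true_and, mul_ite, mul_zero, pow_succ']
        split_ifs <;> ring
      · simp [h]
    · obtain ⟨u, hu, hu'⟩ := h3 z hz
      have hPz : P z ∈ cycles (baseColor F D b) := by
        refine mem_cycles.2 ⟨fun v κ hκ hb => ?_, by rw [← h1, (mem_cycles.1 hz).2, map_zero]⟩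
        rw [h2 v κ hκ, (mem_cycles.1 hz).1 v κ hκ hb, mul_zero, ite_self]
      obtain ⟨w, hw, hw'⟩ := exists_h_smul_sub_colorProj b hPz e
      refine ⟨h F • u + w, add_mem (Submodule.smul_mem _ _ hu) hw, ?_⟩
      rw [map_add, map_smul, ← hu', ← hw', LinearMap.comp_apply, Finset.card_insert_of_notMem he,
        pow_succ', smul_sub, smul_smul]
      abel

/-- A cycle of a reduced complex on which the canonical functional vanishes is a torsion class. -/
theorem exists_smul_eq_differential (b : Bool) {z : Chain F D}
    (hz : z ∈ cycles (baseColor F D b)) (h0 : canonicalEval b z = 0) :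
    ∃ p : F[X], p ≠ 0 ∧ ∃ u ∈ baseColor F D b, p • z = differential F D u := by
  obtain ⟨P, _, h2, h3⟩ := exists_canonicalProj (F := F) b (Finset.univ : Finset D.Edge)
  obtain ⟨u, hu, hu'⟩ := h3 z hz
  refine ⟨h F ^ (Finset.univ : Finset D.Edge).card, pow_ne_zero _ Polynomial.X_ne_zero, u, hu, ?_⟩
  rw [← hu', eq_comm, sub_eq_self]
  refine chain_ext fun v κ hκ => ?_
  rw [h2 v κ hκ, map_zero]
  split_ifs with h
  · obtain rfl : κ = altColor D b := funext fun e => h e (Finset.mem_univ e)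
    obtain rfl := (compatible_iff_of_isAlternating (altColor_isAlternating b) v).1 hκ
    rw [show colorEval _ _ z = 0 from h0, mul_zero]
  · rfl

/-- Lee's canonical generator, up to a power of `h`, is a cycle that is not torsion. -/
theorem exists_canonicalEval_ne_zero (b : Bool) :
    ∃ z ∈ cycles (baseColor F D b), canonicalEval b z ≠ 0 := by
  obtain ⟨P, h1, h2, _⟩ := exists_canonicalProj (F := F) b (Finset.univ : Finset D.Edge)
  let x : Chain F D := stateChain F D (orientedVertex D) fun _ => one
  have hcol : ∀ {v κ}, Compatible v κ → (∀ e ∈ Finset.univ, κ e = altColor D b e) →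
      v = orientedVertex D ∧ κ = altColor D b := by
    intro v κ hκ h
    obtain rfl : κ = altColor D b := funext fun e => h e (Finset.mem_univ e)
    exact ⟨(compatible_iff_of_isAlternating (altColor_isAlternating b) v).1 hκ, rfl⟩
  refine ⟨P x, mem_cycles.2 ⟨fun v κ hκ hb => ?_, ?_⟩, ?_⟩
  · rw [h2 v κ hκ, if_neg]
    intro h
    have := h (D.outEdge none) (Finset.mem_univ _)
    rw [hb, altColor_base] at this
    simp at this
  · rw [← h1]
    refine chain_ext fun v κ hκ => ?_
    rw [h2 v κ hκ, map_zero]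
    split_ifs with h
    · obtain ⟨rfl, rfl⟩ := hcol hκ h
      rw [show colorEval _ _ (differential F D x) = 0 from canonicalEval_differential b x, mul_zero]
    · rfl
  · rw [canonicalEval, h2 _ _ (compatible_altColor b), if_pos fun _ _ => rfl, colorEval_stateChain,
      if_pos rfl, stateWeight]
    refine mul_ne_zero (pow_ne_zero _ Polynomial.X_ne_zero) ?_
    simp [evalCoeff]

theorem cycleClass_eq_zero_iff (C : Submodule F[X] (Chain F D)) (z : cycles C) :
    cycleClass C z = 0 ↔ ∃ p : F[X], p ≠ 0 ∧ ∃ u ∈ C, p • (z : Chain F D) = differential F D u := by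
  rw [cycleClass, LinearMap.comp_apply, Submodule.mkQ_apply, Submodule.Quotient.mk_eq_zero,
    Submodule.mem_torsion_iff]
  constructor
  · rintro ⟨p, hp⟩
    refine ⟨p, nonZeroDivisors.coe_ne_zero p, ?_⟩
    rw [Submonoid.smul_def, ← map_smul, Submodule.mkQ_apply, Submodule.Quotient.mk_eq_zero,
      Submodule.submoduleOf, Submodule.mem_comap] at hp
    obtain ⟨u, hu, hu'⟩ := hp
    exact ⟨u, hu, hu'.symm⟩
  · rintro ⟨p, hp, u, hu, hu'⟩
    refine ⟨⟨p, mem_nonZeroDivisors_of_ne_zero hp⟩, ?_⟩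
    rw [Submonoid.smul_def, ← map_smul, Submodule.mkQ_apply, Submodule.Quotient.mk_eq_zero,
      Submodule.submoduleOf, Submodule.mem_comap]
    exact ⟨u, hu, hu'.symm⟩

/-- The two canonical functionals detect the homology of `C` modulo torsion. -/
def Detected (C : Submodule F[X] (Chain F D)) : Prop :=
  ∀ z ∈ cycles C, (∀ b, canonicalEval b z = 0) →
    ∃ p : F[X], p ≠ 0 ∧ ∃ u ∈ C, p • z = differential F D u

theorem detected_baseColor (b : Bool) : Detected (baseColor F D b) := fun _ hz h0 =>
  exists_smul_eq_differential b hz (h0 b)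

theorem colorProj_mem_cycles (b : Bool) {z : Chain F D} (hz : differential F D z = 0) :
    colorProj (D.outEdge none) b z ∈ cycles (baseColor F D b) :=
  mem_cycles.2 ⟨colorProj_mem_baseColor b z, by rw [← colorProj_differential, hz, map_zero]⟩

/-- `h z = X z + (h - X) z` with `X` acting at the base point, so the unreduced case follows from the
two reduced ones. -/
theorem detected_top : Detected (⊤ : Submodule F[X] (Chain F D)) := by
  intro z hz h0
  have hdz := (mem_cycles.1 hz).2
  have key : ∀ b, ∃ p : F[X], p ≠ 0 ∧ ∃ u ∈ baseColor F D b,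
      p • colorProj (D.outEdge none) b z = differential F D u := fun b =>
    exists_smul_eq_differential b (colorProj_mem_cycles b hdz) (by
      rw [canonicalEval_colorProj, if_pos rfl, h0, mul_zero])
  obtain ⟨p, hp, u, -, hu⟩ := key true
  obtain ⟨q, hq, w, -, hw⟩ := key false
  refine ⟨p * q * h F, mul_ne_zero (mul_ne_zero hp hq) Polynomial.X_ne_zero, q • u + p • w,
    Submodule.mem_top, ?_⟩
  rw [map_add, map_smul, map_smul, ← hu, ← hw]
  simp only [colorProj, if_true, Bool.false_eq_true, if_false, LinearMap.sub_apply,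
    LinearMap.smul_apply, LinearMap.id_apply, smul_sub, smul_smul]
  rw [mul_comm q p, mul_assoc]
  abel

/-- Both canonical functionals together. -/
def canonicalPair : Chain F D →ₗ[F[X]] (Bool → F[X]) := LinearMap.pi canonicalEval

theorem Detected.cycleClass_eq_zero_iff {C : Submodule F[X] (Chain F D)} (hC : Detected C)
    (z : cycles C) : cycleClass C z = 0 ↔ canonicalPair (z : Chain F D) = 0 := by
  rw [BarNatan.cycleClass_eq_zero_iff]
  constructor
  · rintro ⟨p, hp, u, -, hu⟩
    funext b
    have := congrArg (canonicalEval b) hu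
    rw [map_smul, canonicalEval_differential, smul_eq_mul] at this
    exact (mul_eq_zero.1 this).resolve_left hp
  · intro h0
    exact hC z z.2 fun b => congrFun h0 b

theorem cycleClass_surjective (C : Submodule F[X] (Chain F D)) : Function.Surjective (cycleClass C) :=
  (Submodule.mkQ_surjective _).comp (Submodule.mkQ_surjective _)

/-- The homology modulo torsion embeds into `F[h]²` by the canonical functionals. -/
theorem Detected.exists_embedding {C : Submodule F[X] (Chain F D)} (hC : Detected C) :
    ∃ ψ : HomologyModTorsion C →ₗ[F[X]] (Bool → F[X]), LinearMap.ker ψ = ⊥ ∧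
      ∀ z : cycles C, ψ (cycleClass C z) = canonicalPair (z : Chain F D) := by
  have hker : LinearMap.ker (cycleClass C) ≤ LinearMap.ker (canonicalPair ∘ₗ (cycles C).subtype) :=
    fun z hz => (hC.cycleClass_eq_zero_iff z).1 hz
  let e := (cycleClass C).quotKerEquivOfSurjective (cycleClass_surjective C)
  let ψ : HomologyModTorsion C →ₗ[F[X]] (Bool → F[X]) :=
    ((LinearMap.ker (cycleClass C)).liftQ _ hker) ∘ₗ e.symm.toLinearMap
  have hψ : ∀ z : cycles C, ψ (cycleClass C z) = canonicalPair (z : Chain F D) := by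
    intro z
    have : e.symm (cycleClass C z) = Submodule.Quotient.mk z := by
      rw [LinearEquiv.symm_apply_eq]; rfl
    simp only [ψ, LinearMap.comp_apply, LinearEquiv.coe_coe]
    rw [this]
    rfl
  refine ⟨ψ, ?_, hψ⟩
  rw [LinearMap.ker_eq_bot']
  intro y hy
  obtain ⟨z, rfl⟩ := cycleClass_surjective C y
  rw [hψ] at hy
  exact (hC.cycleClass_eq_zero_iff z).2 hy

theorem linearIndependent_and_span_iff_of_ker_eq_bot {R N L ι : Type*} [Ring R] [AddCommGroup N]
    [AddCommGroup L] [Module R N] [Module R L] {ψ : N →ₗ[R] L} (hψ : LinearMap.ker ψ = ⊥)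
    (y : ι → N) : (LinearIndependent R y ∧ Submodule.span R (Set.range y) = ⊤) ↔
      LinearIndependent R (fun i => ψ (y i)) ∧
        ∀ n, ψ n ∈ Submodule.span R (Set.range fun i => ψ (y i)) := by
  refine and_congr (LinearMap.linearIndependent_iff ψ hψ).symm ?_
  rw [show (Set.range fun i => ψ (y i)) = ψ '' Set.range y from Set.range_comp ψ y,
    ← Submodule.map_span, Submodule.eq_top_iff']
  refine forall_congr' fun n => ⟨fun h => ⟨n, h, rfl⟩, ?_⟩
  rintro ⟨n', hn', heq⟩
  rwa [← LinearMap.ker_eq_bot.1 hψ heq]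

theorem Detected.isBasisModTorsion_iff {C : Submodule F[X] (Chain F D)} (hC : Detected C)
    {ι : Type*} (z : ι → Chain F D) : IsBasisModTorsion C z ↔
      (∀ i, z i ∈ cycles C) ∧ LinearIndependent F[X] (fun i => canonicalPair (z i)) ∧
        ∀ w ∈ cycles C,
          canonicalPair w ∈ Submodule.span F[X] (Set.range fun i => canonicalPair (z i)) := by
  obtain ⟨ψ, hψ, hψz⟩ := hC.exists_embedding
  rw [IsBasisModTorsion, ← exists_prop]
  refine exists_congr fun hz => ?_
  rw [linearIndependent_and_span_iff_of_ker_eq_bot hψ, (cycleClass_surjective C).forall]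
  simp only [hψz, Subtype.forall]

/-! ### Bases of the homology modulo torsion -/

theorem isBasisModTorsion_baseColor_iff {b : Bool} {z : Chain F D} :
    IsBasisModTorsion (baseColor F D b) ![z] ↔ z ∈ cycles (baseColor F D b) ∧
      canonicalEval b z ≠ 0 ∧
        ∀ w ∈ cycles (baseColor F D b), canonicalEval b z ∣ canonicalEval b w := by
  rw [(detected_baseColor b).isBasisModTorsion_iff, Set.range_unique]
  simp only [Fin.forall_fin_one, Matrix.cons_val_fin_one]
  refine and_congr_right fun hz => and_congr ?_ ?_
  · rw [linearIndependent_unique_iff, not_iff_not]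
    constructor
    · intro h0
      exact congrFun h0 b
    · intro h0
      funext b'
      by_cases hb : b' = b
      · rw [hb]; exact h0
      · rw [Bool.eq_not.2 hb]
        exact canonicalEval_eq_zero_of_mem hz.1
  · refine forall₂_congr fun w hw => ?_
    rw [Submodule.mem_span_singleton]
    constructor
    · rintro ⟨r, hr⟩
      exact ⟨r, (congrFun hr b).symm.trans (mul_comm _ _)⟩
    · rintro ⟨r, hr⟩
      refine ⟨r, ?_⟩
      funext b'
      by_cases hb : b' = b
      · rw [hb]; exact (mul_comm _ _).trans hr.symm
      · rw [Bool.eq_not.2 hb]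
        exact (congrArg (r * ·) (canonicalEval_eq_zero_of_mem hz.1)).trans
          ((mul_zero r).trans (canonicalEval_eq_zero_of_mem hw.1).symm)

/-- The determinant of two chains with respect to the canonical functionals. -/
def canonicalDet (b : Bool) (x y : Chain F D) : F[X] :=
  canonicalEval b x * canonicalEval (!b) y - canonicalEval (!b) x * canonicalEval b y

theorem IsBasisModTorsion.exists_coeff {x y : Chain F D} (hxy : IsBasisModTorsion ⊤ ![x, y])
    {w : Chain F D} (hw : differential F D w = 0) : ∃ α β : F[X], ∀ b,
      canonicalEval b w = α * canonicalEval b x + β * canonicalEval b y := by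
  have h := ((detected_top.isBasisModTorsion_iff _).1 hxy).2.2 w
    (mem_cycles.2 ⟨Submodule.mem_top, hw⟩)
  rw [show (fun i => canonicalPair (![x, y] i)) = ![canonicalPair x, canonicalPair y] by
    funext i; fin_cases i <;> rfl, Matrix.range_cons_cons_empty, Submodule.mem_span_pair] at h
  obtain ⟨α, β, h⟩ := h
  exact ⟨α, β, fun b => (congrFun h b).symm⟩

theorem IsBasisModTorsion.differential_eq_zero {C : Submodule F[X] (Chain F D)} {ι : Type*}
    {z : ι → Chain F D} (hz : IsBasisModTorsion C z) (i : ι) : differential F D (z i) = 0 :=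
  (hz.choose i).2

theorem isBasisModTorsion_pair_of {x y : Chain F D} (b : Bool) (hx : differential F D x = 0)
    (hy : differential F D y = 0) (hdet : canonicalDet b x y ≠ 0)
    (hspan : ∀ w, differential F D w = 0 → ∃ α β : F[X], ∀ b,
      canonicalEval b w = α * canonicalEval b x + β * canonicalEval b y) :
    IsBasisModTorsion ⊤ ![x, y] := by
  rw [detected_top.isBasisModTorsion_iff,
    show (fun i => canonicalPair (![x, y] i)) = ![canonicalPair x, canonicalPair y] by
      funext i; fin_cases i <;> rfl, Matrix.range_cons_cons_empty, LinearIndependent.pair_iff]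
  refine ⟨?_, ?_, ?_⟩
  · intro i
    fin_cases i
    · exact mem_cycles.2 ⟨Submodule.mem_top, hx⟩
    · exact mem_cycles.2 ⟨Submodule.mem_top, hy⟩
  · intro s t hst
    have e1 : s * canonicalEval b x + t * canonicalEval b y = 0 := congrFun hst b
    have e2 : s * canonicalEval (!b) x + t * canonicalEval (!b) y = 0 := congrFun hst (!b)
    constructor
    · refine (mul_eq_zero.1 ?_).resolve_right hdet
      rw [canonicalDet]
      linear_combination canonicalEval (!b) y * e1 - canonicalEval b y * e2
    · refine (mul_eq_zero.1 ?_).resolve_right hdet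
      rw [canonicalDet]
      linear_combination canonicalEval b x * e2 - canonicalEval (!b) x * e1
  · intro w hw
    obtain ⟨α, β, h⟩ := hspan w hw.2
    exact Submodule.mem_span_pair.2 ⟨α, β, funext fun b => (h b).symm⟩

theorem h_dvd_sub_comp_neg (r : F[X]) : h F ∣ r.comp (- h F) - r := by
  rw [Polynomial.X_dvd_iff, Polynomial.coeff_zero_eq_eval_zero]
  simp [Polynomial.eval_comp]

/-- A generator `z` of the reduced homology modulo torsion and `ν̂ z` form a basis of the unreduced
one.  A cycle `w` differs from `ν̂ (Q w)`, where `Q` projects onto the other reduced complex, by a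
cycle of the given reduced complex. -/
theorem isBasisModTorsion_hatNu {b : Bool} {z : Chain F D}
    (hz : IsBasisModTorsion (baseColor F D b) ![z]) : IsBasisModTorsion ⊤ ![z, hatNu z] := by
  obtain ⟨hzc, hz0, hdvd⟩ := isBasisModTorsion_baseColor_iff.1 hz
  have hzb : canonicalEval (!b) z = 0 := canonicalEval_eq_zero_of_mem hzc.1
  have hh : h F ≠ 0 := Polynomial.X_ne_zero
  have hν := h_mul_canonicalEval_hatNu b z
  have hν' := h_mul_canonicalEval_hatNu (!b) z
  rw [hzb, Polynomial.zero_comp, sub_zero] at hν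
  rw [hzb, Bool.not_not, zero_sub] at hν'
  -- the matrix of values is triangular, with diagonal entries `g` and `-g (-h) / h`
  refine isBasisModTorsion_pair_of b hzc.2 (hatNu_differential_eq_zero hzc.2) ?_ ?_
  · intro h0
    rw [canonicalDet, hzb, zero_mul, sub_zero] at h0
    have h1 := (mul_eq_zero.1 h0).resolve_left hz0
    rw [h1, mul_zero, eq_comm, neg_eq_zero] at hν'
    have h2 := congrArg (fun p => p.comp (- h F)) hν'
    simp only [Polynomial.comp_assoc, Polynomial.zero_comp] at h2
    apply hz0
    simpa using h2
  · intro w hw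
    set y := colorProj (D.outEdge none) (!b) w with hy
    have hyc := colorProj_mem_cycles (!b) hw
    rw [← hy] at hyc
    have hyb : canonicalEval b y = 0 := by
      have := canonicalEval_eq_zero_of_mem hyc.1
      rwa [Bool.not_not] at this
    have hyσ : hatSigma y ∈ cycles (baseColor F D b) := by
      refine mem_cycles.2 ⟨?_, ?_⟩
      · have := hatSigma_mem_baseColor hyc.1
        rwa [Bool.not_not] at this
      · rw [← hatSigma_differential, hyc.2]
        exact chain_ext fun v κ _ => by rw [colorEval_hatSigma]; simp
    have hwc : w - hatNu y ∈ cycles (baseColor F D b) := by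
      refine mem_cycles.2 ⟨?_, by rw [map_sub, hw, hatNu_differential_eq_zero hyc.2, sub_zero]⟩
      intro v κ hκ hb
      apply mul_left_cancel₀ hh
      rw [map_sub, mul_sub, h_mul_colorEval_hatNu, hyc.1 v _ hκ.not (by simp [hb]), hy,
        colorEval_colorProj hκ, if_pos hb, Polynomial.zero_comp, sub_zero, sub_self, mul_zero]
    obtain ⟨p, hp⟩ := hdvd _ hwc
    obtain ⟨r, hr⟩ := hdvd _ hyσ
    obtain ⟨q, hq⟩ := h_dvd_sub_comp_neg r
    have hwb : canonicalEval (!b) w = canonicalEval (!b) (hatNu y) := by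
      have := canonicalEval_eq_zero_of_mem hwc.1
      rwa [map_sub, sub_eq_zero] at this
    have hνy := h_mul_canonicalEval_hatNu b y
    have hνy' := h_mul_canonicalEval_hatNu (!b) y
    rw [Bool.not_not, hyb, Polynomial.zero_comp, sub_zero] at hνy'
    rw [hyb, zero_sub, ← canonicalEval_hatSigma, hr] at hνy
    -- `hatSigma` is an involution, so `y` is `r (-h)` times `hatSigma z` modulo torsion
    have hyr : canonicalEval (!b) y = (canonicalEval b z).comp (- h F) * r.comp (- h F) := by
      rw [← Polynomial.mul_comp, ← hr, canonicalEval_hatSigma, Polynomial.comp_assoc]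
      simp
    rw [hyr] at hνy'
    refine ⟨p + q, -r.comp (- h F), fun b' => mul_left_cancel₀ hh ?_⟩
    by_cases hb : b' = b
    · subst hb
      rw [map_sub, sub_eq_iff_eq_add] at hp
      linear_combination h F * hp + hνy + r.comp (- h F) * hν + canonicalEval b' z * hq
    · obtain rfl : b' = !b := Bool.eq_not.2 hb
      rw [hwb, hzb]
      linear_combination hνy' + r.comp (- h F) * hν'

/-- A class that generates the reduced homology modulo torsion is a basis of it. -/
theorem isBasisModTorsion_of_span_eq_top {b : Bool} (z : cycles (baseColor F D b))
    (hz : Submodule.span F[X] {cycleClass _ z} = ⊤) :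
    IsBasisModTorsion (baseColor F D b) ![(z : Chain F D)] := by
  obtain ⟨ψ, hψ, hψz⟩ := (detected_baseColor (F := F) (D := D) b).exists_embedding
  have hdvd : ∀ w ∈ cycles (baseColor F D b), canonicalEval b (z : Chain F D) ∣ canonicalEval b w := by
    intro w hw
    have : cycleClass _ ⟨w, hw⟩ ∈ Submodule.span F[X] {cycleClass _ z} := by
      rw [hz]; exact Submodule.mem_top
    obtain ⟨r, hr⟩ := Submodule.mem_span_singleton.1 this
    have h2 := congrArg ψ hr
    rw [map_smul, hψz, hψz] at h2
    exact ⟨r, (congrFun h2 b).symm.trans (mul_comm _ _)⟩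
  refine isBasisModTorsion_baseColor_iff.2 ⟨z.2, fun h0 => ?_, hdvd⟩
  obtain ⟨w, hw, hw0⟩ := exists_canonicalEval_ne_zero (F := F) (D := D) b
  have := hdvd w hw
  rw [h0, zero_dvd_iff] at this
  exact hw0 this

/-- The coordinates with respect to a basis of the homology modulo torsion. -/
theorem IsBasisModTorsion.nonempty_equiv {C : Submodule F[X] (Chain F D)} {ι : Type*} [Finite ι]
    {z : ι → Chain F D} (hz : IsBasisModTorsion C z) :
    Nonempty (HomologyModTorsion C ≃ₗ[F[X]] (ι → F[X])) := by
  obtain ⟨_, hli, hsp⟩ := hz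
  exact ⟨(Module.Basis.mk hli hsp.ge).equivFun⟩

/-! ### Gradings -/

/-- The monomial `h ^ (m / 2)` part of a polynomial, that is, its part of degree `m` for
`deg h = 2`; it is `0` if `m` is odd or negative. -/
def gradedPart (m : ℤ) (p : F[X]) : F[X] :=
  ∑ k ∈ p.support.filter fun k : ℕ => 2 * (k : ℤ) = m, Polynomial.monomial k (p.coeff k)

theorem coeff_gradedPart (m : ℤ) (p : F[X]) (k : ℕ) :
    (gradedPart m p).coeff k = if 2 * (k : ℤ) = m then p.coeff k else 0 := by
  rw [gradedPart, Polynomial.finsetSum_coeff]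
  simp only [Polynomial.coeff_monomial]
  rw [Finset.sum_ite_eq']
  by_cases hm : 2 * (k : ℤ) = m <;> by_cases hk : p.coeff k = 0 <;> simp [hm, hk]

theorem gradedPart_zero (m : ℤ) : gradedPart m (0 : F[X]) = 0 := by
  ext k; simp [coeff_gradedPart]

theorem gradedPart_sum {ι : Type*} (s : Finset ι) (m : ℤ) (p : ι → F[X]) :
    gradedPart m (∑ i ∈ s, p i) = ∑ i ∈ s, gradedPart m (p i) := by
  ext k
  simp only [coeff_gradedPart, Polynomial.finsetSum_coeff]
  split_ifs <;> simp

theorem gradedPart_C_mul (m : ℤ) (r : F) (p : F[X]) :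
    gradedPart m (Polynomial.C r * p) = Polynomial.C r * gradedPart m p := by
  ext k
  simp [coeff_gradedPart]

theorem gradedPart_h_pow_mul (m : ℤ) (a : ℕ) (p : F[X]) :
    gradedPart m (h F ^ a * p) = h F ^ a * gradedPart (m - 2 * a) p := by
  ext k
  rw [coeff_gradedPart, Polynomial.coeff_X_pow_mul', Polynomial.coeff_X_pow_mul', coeff_gradedPart]
  split_ifs <;> first | rfl | omega

/-- Homological degree of the states at a vertex. -/
def vertexDegree (v : D.Vertex) : ℤ :=
  ((Finset.univ.filter fun c => v c = true).card : ℤ) - D.nNeg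

/-- The negative of the lowest quantum degree of a state at the vertex `v`, in which all labels are
`1`; this is the shift of the quantum degree under `colorEval`. -/
def quantumShift (v : D.Vertex) : ℤ :=
  (Fintype.card (D.Circle v) : ℤ) + ((Finset.univ.filter fun c => v c = true).card : ℤ) + D.nPos
    - 2 * D.nNeg

theorem qDegree_eq (v : D.Vertex) (l : D.Circle v → Label) : qDegree D ⟨v, l⟩ =
    2 * ((Finset.univ.filter fun k => l k = X).card : ℤ) - quantumShift v := by
  have : ∑ k : D.Circle v, (if l k = X then (1 : ℤ) else -1) =
      2 * ((Finset.univ.filter fun k => l k = X).card : ℤ) - Fintype.card (D.Circle v) := by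
    have h1 : ∀ k, (if l k = X then (1 : ℤ) else -1) = 2 * (if l k = X then (1 : ℤ) else 0) - 1 := by
      intro k; split_ifs <;> rfl
    rw [Finset.sum_congr rfl fun k _ => h1 k, Finset.sum_sub_distrib, ← Finset.mul_sum,
      Finset.sum_boole]
    simp
  rw [qDegree, quantumShift, this]
  ring

theorem stateWeight_eq (v : D.Vertex) (κ : D.Edge → Bool) (l : D.Circle v → Label) :
    stateWeight F v κ l = 0 ∨
      stateWeight F v κ l = h F ^ (Finset.univ.filter fun k => l k = X).card := by
  by_cases hk : ∃ k, l k = X ∧ κ (Quot.out k) = false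
  · obtain ⟨k, h1, h2⟩ := hk
    refine Or.inl (Finset.prod_eq_zero (Finset.mem_univ k) ?_)
    rw [h1, h2, evalCoeff]
  · refine Or.inr ?_
    have : ∀ k, evalCoeff F (κ (Quot.out k)) (l k) = if l k = X then h F else 1 := by
      intro k
      cases hl : l k
      · simp [evalCoeff]
      · rw [if_pos rfl]
        cases hκ : κ (Quot.out k)
        · exact absurd ⟨k, hl, hκ⟩ hk
        · rfl
    rw [stateWeight, Finset.prod_congr rfl fun k _ => this k, Finset.prod_ite]
    simp

/-- The component of a chain in homological degree `i` and quantum degree `j`. -/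
def homogeneousPart (i j : ℤ) (x : Chain F D) : Chain F D := fun s =>
  if hDegree D s = i then gradedPart (j - qDegree D s) (x s) else 0

theorem isHomogeneous_homogeneousPart (i j : ℤ) (x : Chain F D) :
    IsHomogeneous (homogeneousPart i j x) i j := by
  intro s k hk
  rw [homogeneousPart] at hk
  split_ifs at hk with hi
  · rw [coeff_gradedPart] at hk
    split_ifs at hk with hj
    · exact ⟨hi, by omega⟩
    · exact absurd rfl hk
  · exact absurd (Polynomial.coeff_zero k) hk

theorem IsHomogeneous.homogeneousPart_eq {x : Chain F D} {i j : ℤ} (hx : IsHomogeneous x i j) :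
    homogeneousPart i j x = x := by
  funext s
  ext k
  rw [homogeneousPart]
  by_cases hk : (x s).coeff k = 0
  · split_ifs
    · rw [coeff_gradedPart, hk, ite_self]
    · rw [hk, Polynomial.coeff_zero]
  · obtain ⟨h1, h2⟩ := hx s k hk
    rw [if_pos h1, coeff_gradedPart, if_pos (by omega)]

theorem colorEval_homogeneousPart (i j : ℤ) (x : Chain F D) (v : D.Vertex) (κ : D.Edge → Bool) :
    colorEval v κ (homogeneousPart i j x) =
      if vertexDegree v = i then gradedPart (j + quantumShift v) (colorEval v κ x) else 0 := by
  rw [colorEval_apply, colorEval_apply]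
  have happ : ∀ l, homogeneousPart i j x ⟨v, l⟩ =
      if vertexDegree v = i then gradedPart (j - qDegree D ⟨v, l⟩) (x ⟨v, l⟩) else 0 := fun _ => rfl
  simp_rw [happ]
  split_ifs with hi
  · rw [gradedPart_sum]
    refine Finset.sum_congr rfl fun l _ => ?_
    rcases stateWeight_eq (F := F) v κ l with h | h
    · rw [h, zero_mul, zero_mul, gradedPart_zero]
    · rw [h, gradedPart_h_pow_mul, qDegree_eq]
      congr 2
      ring
  · simp

theorem isHomogeneous_iff {x : Chain F D} {i j : ℤ} : IsHomogeneous x i j ↔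
    ∀ v κ, Compatible v κ → ∀ k, (colorEval v κ x).coeff k ≠ 0 →
      vertexDegree v = i ∧ 2 * (k : ℤ) = j + quantumShift v := by
  constructor
  · intro hx v κ _ k hk
    rw [← hx.homogeneousPart_eq, colorEval_homogeneousPart] at hk
    split_ifs at hk with hi
    · rw [coeff_gradedPart] at hk
      split_ifs at hk with hj
      · exact ⟨hi, hj⟩
      · exact absurd rfl hk
    · exact absurd (Polynomial.coeff_zero k) hk
  · intro hx
    have : homogeneousPart i j x = x := by
      refine chain_ext fun v κ hκ => ?_
      rw [colorEval_homogeneousPart]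
      ext k
      by_cases hk : (colorEval v κ x).coeff k = 0
      · split_ifs
        · rw [coeff_gradedPart, hk, ite_self]
        · rw [hk, Polynomial.coeff_zero]
      · obtain ⟨h1, h2⟩ := hx v κ hκ k hk
        rw [if_pos h1, coeff_gradedPart, if_pos h2]
    rw [← this]
    exact isHomogeneous_homogeneousPart i j x

theorem card_filter_flipAt (v : D.Vertex) (c : Fin D.n) (hc : v c = true) :
    ((Finset.univ.filter fun c' => v c' = true).card : ℤ) =
      ((Finset.univ.filter fun c' => flipAt v c c' = true).card : ℤ) + 1 := by
  have : (Finset.univ.filter fun c' => flipAt v c c' = true) =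
      (Finset.univ.filter fun c' => v c' = true).erase c := by
    ext c'
    by_cases h : c' = c
    · subst h; simp [hc]
    · simp [flipAt_ne v h, h]
  rw [this, ← Finset.card_erase_add_one (s := Finset.univ.filter fun c' => v c' = true) (a := c)
    (by simpa using hc)]
  push_cast
  ring

theorem card_circle_flipAt (v : D.Vertex) (c : Fin D.n) :
    (Fintype.card (D.Circle (flipAt v c)) : ℤ) = Fintype.card (D.Circle v) +
      open Classical in
      if D.circle v (D.inEdge (some (c, true))) = D.circle v (D.outEdge (some (c, true)))
      then 1 else -1 := by
  have key : ∀ v : D.Vertex, (Fintype.card (D.Circle v) : ℤ) = ∑ k : D.Circle v, 1 := by simp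
  rw [key, key, sum_circles_eq v c, sum_circles_eq (flipAt v c) c,
    sum_awayCircles_flip v c (fun _ => 1) (fun _ => 1) fun _ _ => rfl]
  have := circle_flip_eq_iff v c
  by_cases h : D.circle v (D.inEdge (some (c, true))) = D.circle v (D.outEdge (some (c, true)))
  · rw [if_pos h, if_pos h, if_neg (fun h' => this.1 h' h)]; ring
  · rw [if_neg h, if_neg h, if_pos (this.2 h)]; ring

/-- The edge maps preserve the quantum degree. -/
theorem gradedPart_edgeWeight_mul (v : D.Vertex) (c : Fin D.n) (hc : v c = true)
    (κ : D.Edge → Bool) (j : ℤ) (p : F[X]) :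
    gradedPart (j + quantumShift v) (edgeWeight F v c κ * p) =
      edgeWeight F v c κ * gradedPart (j + quantumShift (flipAt v c)) p := by
  have hneg : ∀ (m : ℤ) (q : F[X]), gradedPart m (-q) = -gradedPart m q := by
    intro m q
    have := gradedPart_C_mul m (-1) q
    simpa using this
  have hcirc := card_circle_flipAt (flipAt v c) c
  rw [flipAt_flipAt] at hcirc
  have hshift : quantumShift v - quantumShift (flipAt v c) =
      Fintype.card (D.Circle v) - Fintype.card (D.Circle (flipAt v c)) + 1 := by
    rw [quantumShift, quantumShift, card_filter_flipAt v c hc]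
    ring
  rw [edgeWeight]
  split_ifs with h
  · have hsign : ∀ (m : ℤ) (q : F[X]), gradedPart m (cubeSign F (flipAt v c) c * q) =
        cubeSign F (flipAt v c) c * gradedPart m q := by
      intro m q
      rw [cubeSign]
      rcases neg_one_pow_eq_or F[X]
        (Finset.univ.filter fun j => j < c ∧ flipAt v c j = true).card with h | h <;>
        simp [h, hneg]
    rw [mul_assoc, hsign, mul_assoc, bifurcationFactor]
    congr 1
    split_ifs at hcirc ⊢ with hs
    · have hm : j + quantumShift (flipAt v c) = j + quantumShift v - 2 * (1 : ℕ) := by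
        push_cast; linarith
      have := gradedPart_h_pow_mul (j + quantumShift v) 1 p
      rw [pow_one] at this
      rw [hm, handleValue]
      split_ifs
      · exact this
      · rw [neg_mul, hneg, this, neg_mul]
    · rw [one_mul, one_mul]
      congr 1
      linarith
  · rw [zero_mul, zero_mul, gradedPart_zero]

theorem differential_homogeneousPart (i j : ℤ) (x : Chain F D) :
    differential F D (homogeneousPart i j x) =
      homogeneousPart (i + 1) j (differential F D x) := by
  refine chain_ext fun v κ hκ => ?_
  rw [colorEval_homogeneousPart, colorEval_differential hκ, colorEval_differential hκ]
  simp only [colorEval_homogeneousPart]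
  split_ifs with hi
  · rw [gradedPart_sum]
    refine Finset.sum_congr rfl fun c _ => ?_
    split_ifs with h1 h2
    · rw [gradedPart_edgeWeight_mul v c h1]
    · rw [vertexDegree] at hi h2
      rw [card_filter_flipAt v c h1] at hi
      exact absurd (by linarith) h2
    · rw [gradedPart_zero]
  · refine Finset.sum_eq_zero fun c _ => ?_
    split_ifs with h1 h2
    · rw [vertexDegree] at hi h2
      rw [card_filter_flipAt v c h1] at hi
      exact absurd (by linarith) hi
    · rw [mul_zero]
    · rfl

theorem homogeneousPart_zero (i j : ℤ) : homogeneousPart i j (0 : Chain F D) = 0 := by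
  funext s
  simp [homogeneousPart, gradedPart_zero]

theorem homogeneousPart_mem_cycles {b : Bool} {x : Chain F D} (hx : x ∈ cycles (baseColor F D b))
    (i j : ℤ) : homogeneousPart i j x ∈ cycles (baseColor F D b) := by
  refine mem_cycles.2 ⟨fun v κ hκ hb => ?_, ?_⟩
  · rw [colorEval_homogeneousPart, hx.1 v κ hκ hb, gradedPart_zero, ite_self]
  · rw [differential_homogeneousPart, hx.2, homogeneousPart_zero]

theorem vertexDegree_orientedVertex : vertexDegree (orientedVertex D) = 0 := by
  simp [vertexDegree, orientedVertex, GaussDiagram.nNeg]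

theorem coeff_comp_neg_h (p : F[X]) (k : ℕ) : (p.comp (- h F)).coeff k = (-1) ^ k * p.coeff k := by
  induction p using Polynomial.induction_on' with
  | add p q hp hq => simp [hp, hq, mul_add]
  | monomial n a =>
    rw [Polynomial.monomial_comp, neg_pow, ← mul_assoc, Polynomial.coeff_monomial,
      show Polynomial.C a * (-1) ^ n = Polynomial.C (a * (-1) ^ n) by simp,
      Polynomial.coeff_C_mul_X_pow]
    by_cases hk : k = n
    · subst hk; simp [mul_comm]
    · simp [hk, Ne.symm hk]

theorem IsHomogeneous.hatNu {x : Chain F D} {i j : ℤ} (hx : IsHomogeneous x i j) :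
    IsHomogeneous (hatNu x) i (j - 2) := by
  rw [isHomogeneous_iff] at hx ⊢
  intro v κ hκ k hk
  have h1 : (colorEval v κ (BarNatan.hatNu x)).coeff k = (colorEval v κ x).coeff (k + 1) -
      (-1) ^ (k + 1) * (colorEval v (fun e => !κ e) x).coeff (k + 1) := by
    rw [← coeff_comp_neg_h, ← Polynomial.coeff_sub, ← h_mul_colorEval_hatNu,
      Polynomial.coeff_X_mul]
  have h2 : vertexDegree v = i ∧ 2 * ((k + 1 : ℕ) : ℤ) = j + quantumShift v := by
    by_cases h3 : (colorEval v κ x).coeff (k + 1) = 0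
    · refine hx v _ hκ.not (k + 1) fun h4 => hk ?_
      rw [h1, h3, h4, mul_zero, sub_zero]
    · exact hx v κ hκ _ h3
  refine ⟨h2.1, ?_⟩
  have := h2.2
  push_cast at this
  linarith

/-! ### The Rasmussen invariant -/

/-- A polynomial is a multiple of the monomial `h ^ (m / 2)`. -/
def IsMonomial (m : ℤ) (p : F[X]) : Prop := ∀ k, p.coeff k ≠ 0 → 2 * (k : ℤ) = m

theorem IsMonomial.mul {m n : ℤ} {p q : F[X]} (hp : IsMonomial m p) (hq : IsMonomial n q) :
    IsMonomial (m + n) (p * q) := by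
  intro k hk
  rw [Polynomial.coeff_mul] at hk
  obtain ⟨a, ha, hne⟩ := Finset.exists_ne_zero_of_sum_ne_zero hk
  have h1 := hp _ (left_ne_zero_of_mul hne)
  have h2 := hq _ (right_ne_zero_of_mul hne)
  have h3 := Finset.HasAntidiagonal.mem_antidiagonal.1 ha
  omega

theorem IsMonomial.sub {m : ℤ} {p q : F[X]} (hp : IsMonomial m p) (hq : IsMonomial m q) :
    IsMonomial m (p - q) := by
  intro k hk
  by_cases h : p.coeff k = 0
  · refine hq k fun h' => hk ?_
    rw [Polynomial.coeff_sub, h, h', sub_zero]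
  · exact hp k h

theorem IsMonomial.two_mul_natDegree {m : ℤ} {p : F[X]} (hp : IsMonomial m p) (h0 : p ≠ 0) :
    2 * (p.natDegree : ℤ) = m :=
  hp _ (Polynomial.leadingCoeff_ne_zero.2 h0)

theorem IsMonomial.eq_of_dvd {m n : ℤ} {p q : F[X]} (hp : IsMonomial m p) (hq : IsMonomial n q)
    (h0 : q ≠ 0) (hpq : p ∣ q) (hqp : q ∣ p) : m = n := by
  have hp0 : p ≠ 0 := fun h => h0 (zero_dvd_iff.1 (h ▸ hpq))
  rw [← hp.two_mul_natDegree hp0, ← hq.two_mul_natDegree h0,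
    Polynomial.natDegree_eq_of_degree_eq (Polynomial.degree_eq_degree_of_associated
      (associated_of_dvd_dvd hpq hqp))]

theorem IsHomogeneous.isMonomial_canonicalEval {x : Chain F D} {i j : ℤ}
    (hx : IsHomogeneous x i j) (b : Bool) :
    IsMonomial (j + quantumShift (orientedVertex D)) (canonicalEval b x) := fun k hk =>
  (isHomogeneous_iff.1 hx _ _ (compatible_altColor b) k hk).2

theorem IsHomogeneous.isMonomial_canonicalDet {x y : Chain F D} {i i' j j' : ℤ}
    (hx : IsHomogeneous x i j) (hy : IsHomogeneous y i' j') (b : Bool) :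
    IsMonomial (j + quantumShift (orientedVertex D) + (j' + quantumShift (orientedVertex D)))
      (canonicalDet b x y) :=
  ((hx.isMonomial_canonicalEval b).mul (hy.isMonomial_canonicalEval (!b))).sub
    ((hx.isMonomial_canonicalEval (!b)).mul (hy.isMonomial_canonicalEval b))

/-- The reduced homology modulo torsion is generated by a homogeneous cycle: the values of the
canonical functional on cycles form a graded ideal, hence one generated by a power of `h`. -/
theorem exists_homogeneous_generator (b : Bool) : ∃ (j : ℤ) (z : Chain F D),
    IsHomogeneous z 0 j ∧ IsBasisModTorsion (baseColor F D b) ![z] := by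
  classical
  have hex : ∃ k, ∃ z ∈ cycles (baseColor F D b), (canonicalEval b z).coeff k ≠ 0 := by
    obtain ⟨z, hz, hz0⟩ := exists_canonicalEval_ne_zero (F := F) (D := D) b
    exact ⟨_, z, hz, Polynomial.leadingCoeff_ne_zero.2 hz0⟩
  obtain ⟨z, hz, hz0⟩ := Nat.find_spec hex
  have hmin := fun k (hk : k < Nat.find hex) => Nat.find_min hex hk
  set k := Nat.find hex
  let j : ℤ := 2 * k - quantumShift (orientedVertex D)
  have hval : canonicalEval b (homogeneousPart 0 j z) =
      Polynomial.C ((canonicalEval b z).coeff k) * h F ^ k := by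
    rw [canonicalEval, colorEval_homogeneousPart, if_pos vertexDegree_orientedVertex]
    ext a
    rw [coeff_gradedPart, Polynomial.coeff_C_mul_X_pow]
    have : (2 * (a : ℤ) = j + quantumShift (orientedVertex D)) ↔ a = k := by
      simp only [j]; omega
    simp only [this]
    split_ifs with ha
    · rw [ha]
    · rfl
  refine ⟨j, homogeneousPart 0 j z, isHomogeneous_homogeneousPart 0 j z,
    isBasisModTorsion_baseColor_iff.2 ⟨homogeneousPart_mem_cycles hz 0 j, ?_, fun w hw => ?_⟩⟩
  · rw [hval]
    exact mul_ne_zero (Polynomial.C_ne_zero.2 hz0) (pow_ne_zero _ Polynomial.X_ne_zero)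
  · rw [hval, (Polynomial.isUnit_C.2 (isUnit_iff_ne_zero.2 hz0)).mul_left_dvd,
      Polynomial.X_pow_dvd_iff]
    intro a ha
    by_contra h
    exact hmin a ha ⟨w, hw, h⟩

theorem isReducedRasmussenInvariant_iff {b : Bool} {j : ℤ} {z : Chain F D}
    (hz : IsHomogeneous z 0 j) (hzb : IsBasisModTorsion (baseColor F D b) ![z]) (t : ℤ) :
    IsReducedRasmussenInvariant (baseColor F D b) t ↔ t = 1 - j := by
  constructor
  · rintro ⟨a, ha, hab⟩
    obtain ⟨hzc, hz0, hzd⟩ := isBasisModTorsion_baseColor_iff.1 hzb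
    obtain ⟨hac, ha0, had⟩ := isBasisModTorsion_baseColor_iff.1 hab
    have := (ha.isMonomial_canonicalEval b).eq_of_dvd (hz.isMonomial_canonicalEval b) hz0
      (had z hzc) (hzd a hac)
    linarith
  · rintro rfl
    exact ⟨z, by rwa [show -(1 - j) + 1 = j by ring], hzb⟩

/-- A change of basis multiplies the determinant. -/
theorem IsBasisModTorsion.canonicalDet_dvd {x y x' y' : Chain F D}
    (hxy : IsBasisModTorsion ⊤ ![x, y]) (hx' : differential F D x' = 0)
    (hy' : differential F D y' = 0) (b : Bool) : canonicalDet b x y ∣ canonicalDet b x' y' := by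
  obtain ⟨α, β, h1⟩ := hxy.exists_coeff hx'
  obtain ⟨γ, δ, h2⟩ := hxy.exists_coeff hy'
  refine ⟨α * δ - β * γ, ?_⟩
  rw [canonicalDet, canonicalDet, h1, h1, h2, h2]
  ring

theorem IsBasisModTorsion.canonicalDet_ne_zero {x y : Chain F D}
    (hxy : IsBasisModTorsion ⊤ ![x, y]) (b : Bool) : canonicalDet b x y ≠ 0 := by
  obtain ⟨u, hu, hu0⟩ := exists_canonicalEval_ne_zero (F := F) (D := D) b
  obtain ⟨w, hw, hw0⟩ := exists_canonicalEval_ne_zero (F := F) (D := D) (!b)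
  intro h0
  have := hxy.canonicalDet_dvd hu.2 hw.2 b
  rw [h0, zero_dvd_iff, canonicalDet, canonicalEval_eq_zero_of_mem hu.1, zero_mul, sub_zero] at this
  exact mul_ne_zero hu0 hw0 this

theorem isRasmussenInvariant_iff {b : Bool} {j : ℤ} {z : Chain F D}
    (hz : IsHomogeneous z 0 j) (hzb : IsBasisModTorsion (baseColor F D b) ![z]) (t : ℤ) :
    IsRasmussenInvariant F D t ↔ t = 1 - j := by
  have hbasis := isBasisModTorsion_hatNu hzb
  have hz0 : differential F D z = 0 := hbasis.differential_eq_zero 0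
  have hν0 : differential F D (hatNu z) = 0 := hbasis.differential_eq_zero 1
  constructor
  · rintro ⟨x, y, hx, hy, hxy⟩
    have hx0 : differential F D x = 0 := hxy.differential_eq_zero 0
    have hy0 : differential F D y = 0 := hxy.differential_eq_zero 1
    have := (hx.isMonomial_canonicalDet hy b).eq_of_dvd (hz.isMonomial_canonicalDet hz.hatNu b)
      (hbasis.canonicalDet_ne_zero b) (hxy.canonicalDet_dvd hz0 hν0 b)
      (hbasis.canonicalDet_dvd hx0 hy0 b)
    linarith
  · rintro rfl
    refine ⟨hatNu z, z, ?_, by rwa [show -(1 - j) + 1 = j by ring], ?_⟩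
    · rw [show -(1 - j) - 1 = j - 2 by ring]
      exact hz.hatNu
    · refine isBasisModTorsion_pair_of b hν0 hz0 ?_ fun w hw => ?_
      · intro h0
        apply hbasis.canonicalDet_ne_zero b
        rw [canonicalDet] at h0 ⊢
        linear_combination -h0
      · obtain ⟨α, β, h⟩ := hbasis.exists_coeff hw
        exact ⟨β, α, fun b => by rw [h b, add_comm]⟩

end BarNatan

end

theorem mainTheorem6 (F : Type*) [Field F] (D : KnotDiagram)
    (C : Submodule F[X] (Chain F D)) (hC : C = complexX F D ∨ C = complexY F D) :
    Nonempty (HomologyModTorsion C ≃ₗ[F[X]] F[X]) ∧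
    Nonempty (HomologyModTorsion (⊤ : Submodule F[X] (Chain F D)) ≃ₗ[F[X]] (Fin 2 → F[X])) ∧
    (∀ z : cycles C, Submodule.span F[X] {cycleClass C z} = ⊤ →
      IsBasisModTorsion ⊤ ![(z : Chain F D), hatNu (z : Chain F D)]) ∧
    (∃ s : ℤ, (∀ t : ℤ, IsRasmussenInvariant F D t ↔ t = s) ∧
      (∀ t : ℤ, IsReducedRasmussenInvariant C t ↔ t = s)) := by
  obtain ⟨b, rfl⟩ : ∃ b, C = baseColor F D b := by
    rcases hC with rfl | rfl
    · exact ⟨true, complexX_eq⟩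
    · exact ⟨false, complexY_eq⟩
  obtain ⟨j, z, hz, hzb⟩ := exists_homogeneous_generator (F := F) (D := D) b
  refine ⟨?_, (isBasisModTorsion_hatNu hzb).nonempty_equiv,
    fun w hw => isBasisModTorsion_hatNu (isBasisModTorsion_of_span_eq_top w hw), 1 - j,
    isRasmussenInvariant_iff hz hzb, isReducedRasmussenInvariant_iff hz hzb⟩
  obtain ⟨e⟩ := hzb.nonempty_equiv
  exact ⟨e.trans (LinearEquiv.funUnique (Fin 1) F[X] F[X])⟩
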